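/- Throughout, a graph consists of a set $V$ of vertices, a set $E$ of directed edges, origin and terminus maps $o,\tau\colon E\to V$, and a fixed-point free involution $e\mapsto\bar e$ of $E$ with $o(\bar e)=\tau(e)$; loops and multiple edges are allowed. A subgraph is a set of vertices and a set of directed edges closed under $e\mapsto\bar e$ and under taking endpoints; it is proper if it is not the whole graph. A length function on a graph is a function $\ell\colon E\to\mathbb{R}_{>0}$ with $\ell(\bar e)=\ell(e)$. A circuit is a finite sequence $(e_1,\dots,e_n)$, $n\ge 1$, of directed edges such that $\tau(e_i)=o(e_{i+1})$ and $e_i\neq\bar e_{i+1}$ for all $i$ modulo $n$; its length is $\sum_{i=1}^n\ell(e_i)$. For a finite graph $G$, let $\mathcal{C}_{G,\ell}(t)$ be the set of circuits in $G$ of length at most $t$. The entropy of $\ell$ is $$\mathfrak{h}_G(\ell)=\lim_{t\to\infty}\frac1t\log|\mathcal{C}_{G,\ell}(t)|,$$ with the convention that it is $0$ if $G$ has no circuits. **Theorem.** For each integer $r\ge 3$ there is a constant $C_r>0$ with the following property. For every finite connected graph $G$ whose fundamental group $\pi_1(G)$ is free of rank $r$ and every length function $\ell$ on $G$ with $\mathfrak{h}_G(\ell)=1$,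 there is a proper subgraph $G'\subset G$ such that the restriction of $\ell$ to $G'$ satisfies $$\mathfrak{h}_{G'}(\ell|_{G'})\ge C_r.$$ -/

import Mathlib

universe u v

/-- A graph with vertex set `V` and set of directed edges `E`: every directed edge has an
origin and a terminus, and a fixed-point free involution reverses the edges.
Loops and multiple edges are allowed. -/
structure SerreGraph (V : Type u) (E : Type v) where
  /-- origin of a directed edge -/
  o : E → V
  /-- terminus of a directed edge -/
  τ : E → V
  /-- reversal of a directed edge -/
  bar : E → E
  bar_bar : ∀ e, bar (bar e) = e
  bar_ne : ∀ e, bar e ≠ e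
  o_bar : ∀ e, o (bar e) = τ e

namespace SerreGraph

variable {V : Type u} {E : Type v}

theorem τ_bar (G : SerreGraph V E) (e : E) : G.τ (G.bar e) = G.o e := by
  rw [← G.o_bar, G.bar_bar]

/-- `G.IsWalk u p w`: the list of directed edges `p` is an edge path from `u` to `w`
(backtracking is allowed; the empty list is the constant path). -/
def IsWalk (G : SerreGraph V E) : V → List E → V → Prop
  | u, [], w => u = w
  | u, e :: p, w => G.o e = u ∧ IsWalk G (G.τ e) p w

/-- A graph is connected if it is nonempty and any two vertices are joined by an edge path. -/
def Connected (G : SerreGraph V E) : Prop :=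
  Nonempty V ∧ ∀ u w : V, ∃ p : List E, G.IsWalk u p w

/-! ### The fundamental group -/

/-- The group generated by the directed edges, subject to the relations `ē = e⁻¹`. -/
abbrev EdgeGroup (G : SerreGraph V E) : Type v :=
  PresentedGroup (Set.range fun e : E => FreeGroup.of e * FreeGroup.of (G.bar e))

/-- The element of the edge group represented by a list of directed edges. Two edge paths with
the same endpoints represent the same element if and only if they are homotopic, that is,
differ by insertions and deletions of backtracks `e ē`. -/
def word (G : SerreGraph V E) (p : List E) : G.EdgeGroup :=
  (p.map fun e => (PresentedGroup.of e : G.EdgeGroup)).prod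

theorem IsWalk.append {G : SerreGraph V E} {p q : List E} {a b c : V}
    (hp : G.IsWalk a p b) (hq : G.IsWalk b q c) : G.IsWalk a (p ++ q) c := by
  induction p generalizing a with
  | nil => cases hp; exact hq
  | cons e p ih => exact ⟨hp.1, ih hp.2⟩

theorem IsWalk.reverse {G : SerreGraph V E} {p : List E} {a b : V}
    (hp : G.IsWalk a p b) : G.IsWalk b (p.map G.bar).reverse a := by
  induction p generalizing a with
  | nil => cases hp; rfl
  | cons e p ih =>
    rw [List.map_cons, List.reverse_cons]
    exact (ih hp.2).append ⟨G.o_bar e, (G.τ_bar e).trans hp.1⟩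

theorem of_bar (G : SerreGraph V E) (e : E) :
    (PresentedGroup.of (G.bar e) : G.EdgeGroup) = (PresentedGroup.of e)⁻¹ := by
  rw [eq_comm, inv_eq_iff_mul_eq_one]
  exact PresentedGroup.one_of_mem (Set.mem_range_self e)

theorem word_append (G : SerreGraph V E) (p q : List E) :
    G.word (p ++ q) = G.word p * G.word q := by
  simp [word]

theorem word_reverse (G : SerreGraph V E) (p : List E) :
    G.word (p.map G.bar).reverse = (G.word p)⁻¹ := by
  induction p with
  | nil => simp [word]
  | cons e p ih =>
    rw [List.map_cons, List.reverse_cons, word_append, ih]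
    simp [word, of_bar]

/-- The fundamental group `π₁(G, x)`: the group of homotopy classes of closed edge paths
based at `x`, realized as the subgroup of the edge group formed by these classes. -/
def fundamentalGroup (G : SerreGraph V E) (x : V) : Subgroup G.EdgeGroup where
  carrier := {g | ∃ p : List E, G.IsWalk x p x ∧ G.word p = g}
  one_mem' := ⟨[], rfl, rfl⟩
  mul_mem' := by
    rintro _ _ ⟨p, hp, rfl⟩ ⟨q, hq, rfl⟩
    exact ⟨p ++ q, hp.append hq, G.word_append p q⟩
  inv_mem' := by
    rintro _ ⟨p, hp, rfl⟩
    exact ⟨_, hp.reverse, G.word_reverse p⟩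

/-- `rk π₁(G) = r`: the fundamental group (at every base point) is free of rank `r`. -/
def HasRank (G : SerreGraph V E) (r : ℕ) : Prop :=
  ∀ x : V, Nonempty (G.fundamentalGroup x ≃* FreeGroup (Fin r))

/-! ### Length functions and entropy -/

/-- A length function: a positive length for every edge, the same for both of its directions. -/
structure LengthFunction (G : SerreGraph V E) where
  /-- the length of a directed edge -/
  len : E → ℝ
  pos : ∀ e, 0 < len e
  len_bar : ∀ e, len (G.bar e) = len e

/-- The directed edge `e'` may follow `e` in a circuit: it starts where `e` ends, and it is not
the reverse of `e`. -/
def Follows (G : SerreGraph V E) (e e' : E) : Prop :=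
  G.τ e = G.o e' ∧ e ≠ G.bar e'

/-- A based circuit: a nonempty finite sequence of directed edges `(e₁, …, eₙ)`, each followed
by the next and the last followed by the first. -/
def IsCircuit (G : SerreGraph V E) (γ : List E) : Prop :=
  ∃ h : γ ≠ [], γ.IsChain G.Follows ∧ G.Follows (γ.getLast h) (γ.head h)

/-- The set of based circuits of length at most `t` (a finite set if the graph is finite). -/
def circuits (G : SerreGraph V E) (ℓ : G.LengthFunction) (t : ℝ) : Set (List E) :=
  {γ | G.IsCircuit γ ∧ (γ.map ℓ.len).sum ≤ t}

/-- `ℓ` has entropy `h`: the limit of `log |{circuits of length ≤ t}| / t` as `t → ∞`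
exists and equals `h`. (With `Real.log 0 = 0`, a graph without circuits has entropy `0`.) -/
def HasEntropy (G : SerreGraph V E) (ℓ : G.LengthFunction) (h : ℝ) : Prop :=
  Filter.Tendsto (fun t : ℝ => Real.log ((G.circuits ℓ t).ncard : ℝ) / t) Filter.atTop (nhds h)

/-! ### Subgraphs -/

/-- A subgraph: a set of vertices and a set of directed edges, closed under reversal and under
taking endpoints. -/
structure Subgraph (G : SerreGraph V E) where
  /-- the vertices of the subgraph -/
  verts : Set V
  /-- the directed edges of the subgraph -/
  edges : Set E
  bar_mem : ∀ e ∈ edges, G.bar e ∈ edges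
  o_mem : ∀ e ∈ edges, G.o e ∈ verts

/-- A subgraph is proper if it is not the whole graph. -/
def Subgraph.IsProper {G : SerreGraph V E} (H : G.Subgraph) : Prop :=
  ¬ (H.verts = Set.univ ∧ H.edges = Set.univ)

/-- A subgraph as a graph in its own right. -/
def Subgraph.toGraph {G : SerreGraph V E} (H : G.Subgraph) : SerreGraph H.verts H.edges where
  o e := ⟨G.o e, H.o_mem e e.2⟩
  τ e := ⟨G.τ e, G.o_bar e ▸ H.o_mem _ (H.bar_mem e e.2)⟩
  bar e := ⟨G.bar e, H.bar_mem e e.2⟩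
  bar_bar e := Subtype.ext (G.bar_bar e)
  bar_ne e h := G.bar_ne e (congrArg Subtype.val h)
  o_bar e := Subtype.ext (G.o_bar e)

/-- The restriction of a length function to a subgraph. -/
def LengthFunction.restrict {G : SerreGraph V E} (ℓ : G.LengthFunction) (H : G.Subgraph) :
    H.toGraph.LengthFunction where
  len e := ℓ.len e
  pos e := ℓ.pos e
  len_bar e := ℓ.len_bar e

end SerreGraph

/-! Entropy 1 yields a nonnegative subsolution `w`, with maximum 1, of the transfer operator with
exponent 1/2 (`HasEntropy.exists_subsolution`): if the weighted path sums were bounded, the entropy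
would be at most 1/2. Rank r means |E| = 2|V| + 2r - 2 (`card_edges_eq`), so without dead ends the
surplus of followers, summed over all directed edges, is at most q = 2r(2r - 2).

Let `σ` send each edge to a heaviest follower. Along a `σ`-orbit without repetition, the starting
weight is at most 2^q exp(-length/2) (`IsDominant.le_iterate`). The orbit of an edge of weight 1
therefore closes up to a simple circuit of length A ≤ 4q log 2. Going around the circuit only
multiplies weights by exp(-A/2), so some edge `b` leaving it has weight at least a constant times 1
- exp(-A/2) (`IsDominant.exists_isExit`). Following `σ` from `b` until the path hits the circuit or
itself adds a path of length L, with exp(-L/2) at least a constant times 1 - exp(-A/2). Circuit and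
path together carry two loops x, y with different first edges (`IsExit.exists_loop`). They contain
at most two independent cycles, so for r ≥ 3 they miss an edge.

The circuit may be arbitrarily short, which forces no bound on L. The remedy is to use the words x^i
y with i < N and N about 1/(1 - exp(-A/2)): their lengths are at most K + 4 log N with K depending
only on q, so the entropy is at least log N / (K + 4 log N), bounded below
(`exists_entropyBound_le`). -/

namespace SerreGraph

open Filter Topology

variable {V : Type u} {E : Type v}

/-! ### Trails -/

/-- `G.Trail z x w`: starting after the edge `z`, the edges of the list `x` can be traversed
without backtracking, and the last edge of `z :: x` is `w`. -/
def Trail (G : SerreGraph V E) : E → List E → E → Prop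
  | z, [], w => z = w
  | z, e :: x, w => G.Follows z e ∧ Trail G e x w

theorem Trail.append {G : SerreGraph V E} {x y : List E} {a b c : E}
    (hx : G.Trail a x b) (hy : G.Trail b y c) : G.Trail a (x ++ y) c := by
  induction x generalizing a with
  | nil => cases hx; exact hy
  | cons e x ih => exact ⟨hx.1, ih hx.2⟩

theorem trail_cons_iff {G : SerreGraph V E} {z e w : E} {x : List E} :
    G.Trail z (e :: x) w ↔ G.Follows z e ∧ (e :: x).IsChain G.Follows ∧
      (e :: x).getLast (List.cons_ne_nil e x) = w := by
  induction x generalizing z e with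
  | nil => simp [Trail]
  | cons f x ih =>
    rw [Trail, ih, List.isChain_cons_cons, List.getLast_cons (List.cons_ne_nil f x), and_assoc]

/-- The witness `z` is the last edge of `γ`, so the cyclic closing condition becomes the first step
of a trail. Loops at a common `z` can be concatenated. -/
theorem isCircuit_iff {G : SerreGraph V E} {γ : List E} :
    G.IsCircuit γ ↔ γ ≠ [] ∧ ∃ z, G.Trail z γ z := by
  cases γ with
  | nil => simp [IsCircuit]
  | cons e x =>
    simp only [IsCircuit, trail_cons_iff, List.head_cons]
    constructor
    · rintro ⟨h, hc, hf⟩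
      exact ⟨h, _, hf, hc, rfl⟩
    · rintro ⟨h, z, hf, hc, rfl⟩
      exact ⟨h, hc, hf⟩

theorem follows_bar {G : SerreGraph V E} {e f : E} (h : G.Follows e f) :
    G.Follows (G.bar f) (G.bar e) := by
  refine ⟨by rw [G.τ_bar, G.o_bar, h.1], fun h' => h.2 ?_⟩
  rw [h', G.bar_bar]

/-- A trail omits its starting edge and contains its last one; reversal exchanges these roles,
whence the correction by the lengths of `z` and `w`. -/
theorem Trail.exists_reverse {G : SerreGraph V E} (ℓ : G.LengthFunction) {x : List E} {z w : E}
    (hx : G.Trail z x w) : ∃ y, G.Trail (G.bar w) y (G.bar z) ∧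
      (y.map ℓ.len).sum + ℓ.len w = ℓ.len z + (x.map ℓ.len).sum ∧
      ∀ e ∈ y, G.bar e ∈ z :: x := by
  induction x generalizing z with
  | nil =>
    cases hx
    exact ⟨[], rfl, by simp, by simp⟩
  | cons e x ih =>
    obtain ⟨y, hy, hs, hm⟩ := ih hx.2
    refine ⟨y ++ [G.bar z], hy.append ⟨follows_bar hx.1, rfl⟩, ?_, ?_⟩
    · simp only [List.map_append, List.sum_append, List.map_cons, List.map_nil, List.sum_cons,
        List.sum_nil, ℓ.len_bar]
      linarith
    · intro f hf
      rcases List.mem_append.1 hf with hf | hf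
      · exact List.mem_cons_of_mem _ (hm f hf)
      · rw [List.mem_singleton.1 hf, G.bar_bar]
        exact List.mem_cons_self

theorem Trail.flatten {G : SerreGraph V E} {z : E} {L : List (List E)}
    (hL : ∀ x ∈ L, G.Trail z x z) : G.Trail z L.flatten z := by
  induction L with
  | nil => rfl
  | cons x L ih =>
    rw [List.flatten_cons]
    exact (hL x List.mem_cons_self).append (ih fun y hy => hL y (List.mem_cons_of_mem _ hy))

/-! ### Circuits of bounded length -/

theorem LengthFunction.sum_nonneg {G : SerreGraph V E} (ℓ : G.LengthFunction) (x : List E) :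
    0 ≤ (x.map ℓ.len).sum :=
  List.sum_nonneg fun a ha => by
    obtain ⟨e, -, rfl⟩ := List.mem_map.1 ha
    exact (ℓ.pos e).le

theorem LengthFunction.exists_le_len [Finite E] {G : SerreGraph V E} (ℓ : G.LengthFunction) :
    ∃ ε : ℝ, 0 < ε ∧ ∀ e, ε ≤ ℓ.len e := by
  cases isEmpty_or_nonempty E
  · exact ⟨1, one_pos, fun e => isEmptyElim e⟩
  · obtain ⟨e, he⟩ := Finite.exists_min ℓ.len
    exact ⟨ℓ.len e, ℓ.pos e, he⟩

theorem LengthFunction.length_mul_le {G : SerreGraph V E} (ℓ : G.LengthFunction) {ε : ℝ}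
    (hε : ∀ e, ε ≤ ℓ.len e) (x : List E) : x.length * ε ≤ (x.map ℓ.len).sum := by
  induction x with
  | nil => simp
  | cons e x ih =>
    simp only [List.length_cons, Nat.cast_add, Nat.cast_one, List.map_cons, List.sum_cons]
    linarith [hε e]

theorem LengthFunction.finite_sum_le [Finite E] {G : SerreGraph V E} (ℓ : G.LengthFunction)
    (t : ℝ) : {x : List E | (x.map ℓ.len).sum ≤ t}.Finite := by
  obtain ⟨ε, hε, hle⟩ := ℓ.exists_le_len
  refine (List.finite_length_le E ⌊t / ε⌋₊).subset fun x hx => ?_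
  refine Nat.le_floor ((le_div_iff₀ hε).2 ((ℓ.length_mul_le hle x).trans hx))

theorem finite_circuits [Finite E] (G : SerreGraph V E) (ℓ : G.LengthFunction) (t : ℝ) :
    (G.circuits ℓ t).Finite :=
  (ℓ.finite_sum_le t).subset fun _ hx => hx.2

theorem ncard_circuits_mono [Finite E] (G : SerreGraph V E) (ℓ : G.LengthFunction) :
    Monotone fun t => (G.circuits ℓ t).ncard := fun _ t hst =>
  Set.ncard_le_ncard (fun _ hx => ⟨hx.1, hx.2.trans hst⟩) (G.finite_circuits ℓ t)

/-- Unique decoding: of the two first words one is a prefix of the other, so they agree and cancel.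
-/
theorem eq_of_flatten_eq_of_prefix_free {α : Type*} {S : Set (List α)}
    (hS : ∀ x ∈ S, ∀ y ∈ S, x <+: y → x = y) {L L' : List (List α)}
    (hlen : L.length = L'.length) (hL : ∀ x ∈ L, x ∈ S) (hL' : ∀ x ∈ L', x ∈ S)
    (h : L.flatten = L'.flatten) : L = L' := by
  induction L generalizing L' with
  | nil => exact (List.eq_nil_of_length_eq_zero hlen.symm).symm
  | cons x L ih =>
    cases L' with
    | nil => simp at hlen
    | cons y L' =>
      rw [List.flatten_cons, List.flatten_cons] at h
      have hx := hL x List.mem_cons_self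
      have hy := hL' y List.mem_cons_self
      have hxy : x = y := by
        rcases List.prefix_or_prefix_of_prefix (List.prefix_append x L.flatten)
          (h ▸ List.prefix_append y L'.flatten) with hp | hp
        · exact hS x hx y hy hp
        · exact (hS y hy x hx hp).symm
      subst hxy
      rw [ih (by simpa using hlen) (fun z hz => hL z (List.mem_cons_of_mem _ hz))
        (fun z hz => hL' z (List.mem_cons_of_mem _ hz)) (List.append_cancel_left h)]

/-- A prefix-free set of loops at the same edge generates freely a set of circuits. -/
theorem card_pow_le_ncard_circuits [Finite E] (G : SerreGraph V E) (ℓ : G.LengthFunction) {z : E}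
    {S : Finset (List E)} {T : ℝ} (hne : ∀ x ∈ S, x ≠ []) (hS : ∀ x ∈ S, G.Trail z x z)
    (hpre : ∀ x ∈ S, ∀ y ∈ S, x <+: y → x = y) (hT : ∀ x ∈ S, (x.map ℓ.len).sum ≤ T)
    {k : ℕ} (hk : k ≠ 0) : S.card ^ k ≤ (G.circuits ℓ (k * T)).ncard := by
  let F : (Fin k → S) → List E := fun f => (List.ofFn fun i => (f i : List E)).flatten
  have hmem : ∀ f : Fin k → S, ∀ x ∈ List.ofFn fun i => (f i : List E), x ∈ S := by
    intro f x hx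
    obtain ⟨i, rfl⟩ := (List.mem_ofFn' _ _).1 hx
    exact (f i).2
  have hinj : Function.Injective F := by
    intro f g hfg
    have h := eq_of_flatten_eq_of_prefix_free (S := S) hpre (by simp) (hmem f) (hmem g) hfg
    funext i
    exact Subtype.ext (congrFun (List.ofFn_injective h) i)
  have hsum : ∀ L : List (List E), (∀ x ∈ L, x ∈ S) →
      (L.flatten.map ℓ.len).sum ≤ L.length * T := by
    intro L hL
    induction L with
    | nil => simp
    | cons x L ih =>
      have h1 := hT x (hL x List.mem_cons_self)
      have h2 := ih fun y hy => hL y (List.mem_cons_of_mem _ hy)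
      simp only [List.flatten_cons, List.map_append, List.sum_append, List.length_cons,
        Nat.cast_add, Nat.cast_one]
      linarith
  have hsub : Set.range F ⊆ G.circuits ℓ (k * T) := by
    rintro _ ⟨f, rfl⟩
    refine ⟨isCircuit_iff.2 ⟨?_, z, Trail.flatten fun x hx => hS x (hmem f x hx)⟩, ?_⟩
    · intro h0
      have h1 := List.flatten_eq_nil_iff.1 h0 (f ⟨0, Nat.pos_of_ne_zero hk⟩)
        ((List.mem_ofFn' _ _).2 ⟨_, rfl⟩)
      exact hne _ (f _).2 h1
    · exact (hsum _ (hmem f)).trans_eq (by rw [List.length_ofFn])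
  calc S.card ^ k = Nat.card (Fin k → S) := by simp
    _ = (Set.range F).ncard := (Set.ncard_range_of_injective hinj).symm
    _ ≤ _ := Set.ncard_le_ncard hsub (G.finite_circuits ℓ _)

/-! ### Existence of the entropy -/

/-- A variant of Fekete's lemma. The function `g` differs from the quotient only by log(ct)/t, which
tends to 0, and filling [0, t] with ⌊t/t₀⌋ windows of length t₀ bounds the quotient at t below by
nearly g(t₀). The limit is the supremum of `g`, cut off at 0 because of `Real.log 0 = 0`. -/
theorem exists_tendsto_log_div {N : ℝ → ℕ} (hN : Monotone N) {c : ℝ} (hc : 1 ≤ c)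
    (hpow : ∀ t : ℝ, 1 ≤ t → ∀ k : ℕ, k ≠ 0 → ((N t : ℝ) / (c * t)) ^ k ≤ N (k * t))
    {B : ℝ} (hB : ∀ᶠ t in atTop, Real.log (N t) / t ≤ B) :
    ∃ h, Tendsto (fun t : ℝ => Real.log (N t) / t) atTop (𝓝 h) := by
  obtain ⟨T, hT⟩ := eventually_atTop.1 (hB.and (eventually_ge_atTop 1))
  have hT1 : 1 ≤ T := (hT T le_rfl).2
  set g : ℝ → ℝ := fun t => Real.log (N t / (c * t)) / t with hg
  have hf0 : ∀ t, 1 ≤ t → 0 ≤ Real.log (N t) / t := fun t ht =>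
    div_nonneg (Real.log_natCast_nonneg _) (by linarith)
  have hlog0 : ∀ t, 1 ≤ t → 0 ≤ Real.log (c * t) := fun t ht =>
    Real.log_nonneg (by nlinarith)
  have hfg : ∀ t, 1 ≤ t → N t ≠ 0 → Real.log (N t) / t = g t + Real.log (c * t) / t := by
    intro t ht h0
    rw [hg]
    simp only
    rw [Real.log_div (by exact_mod_cast h0) (by positivity)]
    ring
  have hgz : ∀ t, N t = 0 → g t = 0 := fun t h0 => by simp [hg, h0]
  set A : Set ℝ := (fun t => max (g t) 0) '' Set.Ici T with hA
  have hbdd : BddAbove A := by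
    refine ⟨max B 0, ?_⟩
    rintro _ ⟨t, ht, rfl⟩
    have ht1 : 1 ≤ t := hT1.trans ht
    refine max_le_max ?_ le_rfl
    by_cases h0 : N t = 0
    · rw [hgz t h0]
      exact (hf0 t ht1).trans (hT t ht).1
    · have := hfg t ht1 h0
      have h2 := div_nonneg (hlog0 t ht1) (by linarith : (0 : ℝ) ≤ t)
      linarith [(hT t ht).1]
  have hne : A.Nonempty := ⟨_, T, Set.self_mem_Ici, rfl⟩
  refine ⟨sSup A, tendsto_order.2 ⟨fun a ha => ?_, fun a ha => ?_⟩⟩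
  · by_cases ha0 : a < 0
    · filter_upwards [eventually_ge_atTop 1] with t ht using ha0.trans_le (hf0 t ht)
    · obtain ⟨_, ⟨t₀, ht₀, rfl⟩, hlt⟩ := exists_lt_of_lt_csSup hne ha
      have hga : a < g t₀ := by
        rcases lt_max_iff.1 hlt with h | h
        · exact h
        · exact absurd h ha0
      have ht₀1 : 1 ≤ t₀ := hT1.trans ht₀
      have hlow : ∀ t, t₀ ≤ t → (1 - t₀ / t) * g t₀ ≤ Real.log (N t) / t := by
        intro t ht
        have htpos : 0 < t := by linarith
        have ht₀pos : 0 < t₀ := by linarith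
        have hkpos : ⌊t / t₀⌋₊ ≠ 0 := by
          rw [← Nat.pos_iff_ne_zero, Nat.floor_pos]
          exact (one_le_div ht₀pos).2 ht
        have hk1 : (⌊t / t₀⌋₊ : ℝ) * t₀ ≤ t :=
          (le_div_iff₀ ht₀pos).1 (Nat.floor_le (by positivity))
        have hk2 : t - t₀ ≤ (⌊t / t₀⌋₊ : ℝ) * t₀ := by
          have := Nat.lt_floor_add_one (t / t₀)
          rw [div_lt_iff₀ ht₀pos] at this
          linarith
        have hN0 : N t₀ ≠ 0 := fun h0 => by
          rw [hgz t₀ h0] at hga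
          exact ha0 hga
        have hx : 0 < (N t₀ : ℝ) / (c * t₀) := by positivity
        have h1 := (hpow t₀ ht₀1 _ hkpos).trans
          (Nat.cast_le.2 (hN hk1) : (N (⌊t / t₀⌋₊ * t₀) : ℝ) ≤ N t)
        have h2 := Real.log_le_log (pow_pos hx _) h1
        rw [Real.log_pow] at h2
        have h3 : Real.log (N t₀ / (c * t₀)) = t₀ * g t₀ := by
          rw [hg]; field_simp
        rw [h3] at h2
        rw [le_div_iff₀ htpos]
        have h4 : (1 - t₀ / t) * g t₀ * t = (t - t₀) * g t₀ := by field_simp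
        rw [h4]
        have hgpos : 0 ≤ g t₀ := by linarith
        nlinarith
      have hlim : Tendsto (fun t : ℝ => (1 - t₀ / t) * g t₀) atTop (𝓝 ((1 - 0) * g t₀)) :=
        (tendsto_const_nhds.sub (tendsto_const_nhds.div_atTop tendsto_id)).mul_const _
      have := (tendsto_order.1 hlim).1 a (by linarith)
      filter_upwards [this, eventually_ge_atTop t₀] with t h1 h2 using h1.trans_le (hlow t h2)
  · have hlim : Tendsto (fun t : ℝ => sSup A + Real.log (c * t) / t) atTop (𝓝 (sSup A + 0)) := by
      refine tendsto_const_nhds.add ?_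
      have h1 : Tendsto (fun t : ℝ => Real.log c / t + Real.log t / t) atTop (𝓝 (0 + 0)) := by
        refine (tendsto_const_nhds.div_atTop tendsto_id).add ?_
        simpa using Real.tendsto_pow_log_div_mul_add_atTop 1 0 1 one_ne_zero
      rw [add_zero] at h1
      refine h1.congr' ?_
      filter_upwards [eventually_gt_atTop 0] with t ht
      rw [Real.log_mul (by positivity) ht.ne', add_div]
    have := (tendsto_order.1 hlim).2 a (by linarith)
    filter_upwards [this, eventually_ge_atTop T] with t h1 h2
    have ht1 : 1 ≤ t := hT1.trans h2
    have hle : max (g t) 0 ≤ sSup A := le_csSup hbdd ⟨t, h2, rfl⟩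
    refine lt_of_le_of_lt ?_ h1
    by_cases h0 : N t = 0
    · have h2 := div_nonneg (hlog0 t ht1) (by linarith : (0 : ℝ) ≤ t)
      have h3 := (le_max_right (g t) 0).trans hle
      simp only [h0, Nat.cast_zero, Real.log_zero, zero_div]
      linarith
    · rw [hfg t ht1 h0]
      linarith [(le_max_left (g t) 0).trans hle]

/-- Pigeonhole on the last edge and the number of edges: for t ≥ 1 there are at most c t classes.
The circuits in one class are loops at the same edge, and equal numbers of edges make them
prefix-free. -/
theorem exists_pow_le_ncard_circuits [Finite E] (G : SerreGraph V E) (ℓ : G.LengthFunction) :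
    ∃ c : ℝ, 1 ≤ c ∧ ∀ t : ℝ, 1 ≤ t → ∀ k : ℕ, k ≠ 0 →
      (((G.circuits ℓ t).ncard : ℝ) / (c * t)) ^ k ≤ (G.circuits ℓ (k * t)).ncard := by
  classical
  obtain ⟨ε, hε, hle⟩ := ℓ.exists_le_len
  have := Fintype.ofFinite E
  cases isEmpty_or_nonempty E with
  | inl h =>
    refine ⟨1, le_rfl, fun t ht k hk => ?_⟩
    have h0 : ∀ t, G.circuits ℓ t = ∅ := fun t => by
      refine Set.eq_empty_of_forall_notMem fun x hx => ?_
      obtain ⟨hx, -⟩ := hx.1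
      exact hx (List.eq_nil_of_length_eq_zero (by
        cases x with
        | nil => rfl
        | cons e x => exact isEmptyElim e))
    simp [h0, hk]
  | inr h =>
    have hcard : (1 : ℝ) ≤ Fintype.card E := by exact_mod_cast Fintype.card_pos
    refine ⟨Fintype.card E * (1 / ε + 1), ?_, fun t ht k hk => ?_⟩
    · have : 0 ≤ 1 / ε := by positivity
      nlinarith
    set A := (G.finite_circuits ℓ t).toFinset with hA
    have hcardA : (G.circuits ℓ t).ncard = A.card := Set.ncard_eq_toFinset_card _ _
    let φ : List E → E × ℕ := fun x =>
      (if hx : x ≠ [] then x.getLast hx else Classical.arbitrary E, x.length)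
    set P : Finset (E × ℕ) := Finset.univ ×ˢ Finset.range (⌊t / ε⌋₊ + 1) with hP
    have hmaps : ∀ x ∈ A, φ x ∈ P := by
      intro x hx
      have hx' : x ∈ G.circuits ℓ t := by simpa [hA] using hx
      simp only [hP, Finset.mem_product, Finset.mem_univ, true_and, Finset.mem_range,
        Nat.lt_succ_iff, φ]
      exact Nat.le_floor ((le_div_iff₀ hε).2 ((ℓ.length_mul_le hle x).trans hx'.2))
    have hPne : P.Nonempty := by
      simp [hP]
    have hPcard : (P.card : ℝ) ≤ Fintype.card E * (1 / ε + 1) * t := by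
      rw [hP, Finset.card_product, Finset.card_univ, Finset.card_range, mul_assoc]
      push_cast
      refine mul_le_mul_of_nonneg_left ?_ (by linarith)
      have := Nat.floor_le (show 0 ≤ t / ε by positivity)
      have h2 : (1 / ε + 1) * t = t / ε + t := by ring
      linarith
    have hPpos : (0 : ℝ) < P.card := by exact_mod_cast hPne.card_pos
    obtain ⟨⟨z, n⟩, -, hS⟩ := Finset.exists_le_card_fiber_of_nsmul_le_card_of_maps_to hmaps hPne
      (b := (A.card : ℝ) / P.card) (by rw [nsmul_eq_mul]; field_simp; exact le_rfl)
    set S := A.filter fun x => φ x = (z, n)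
    have hmem : ∀ x ∈ S, x ∈ G.circuits ℓ t ∧ φ x = (z, n) := by
      intro x hx
      simpa [S, hA] using hx
    have hne : ∀ x ∈ S, x ≠ [] := fun x hx => (hmem x hx).1.1.1
    have htr : ∀ x ∈ S, G.Trail z x z := by
      intro x hx
      obtain ⟨⟨⟨h1, h2, h3⟩, h4⟩, h5⟩ := hmem x hx
      have h6 : x.getLast h1 = z := by
        have := congrArg Prod.fst h5
        simpa [φ, h1] using this
      cases x with
      | nil => exact absurd rfl h1
      | cons e x => exact trail_cons_iff.2 ⟨h6 ▸ h3, h2, h6⟩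
    have hlen : ∀ x ∈ S, x.length = n := fun x hx => congrArg Prod.snd (hmem x hx).2
    have key := G.card_pow_le_ncard_circuits ℓ hne htr
      (fun x hx y hy hxy => hxy.eq_of_length ((hlen x hx).trans (hlen y hy).symm))
      (fun x hx => (hmem x hx).1.2) hk
    refine le_trans ?_ (by exact_mod_cast key : (S.card : ℝ) ^ k ≤ _)
    refine pow_le_pow_left₀ (by positivity) (le_trans ?_ hS) k
    rw [hcardA]
    exact div_le_div_of_nonneg_left (by positivity) hPpos hPcard

theorem exists_hasEntropy [Finite E] (G : SerreGraph V E) (ℓ : G.LengthFunction) {B : ℝ}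
    (hB : ∀ᶠ t in atTop, Real.log ((G.circuits ℓ t).ncard : ℝ) / t ≤ B) :
    ∃ h, G.HasEntropy ℓ h := by
  obtain ⟨c, hc, hpow⟩ := G.exists_pow_le_ncard_circuits ℓ
  exact exists_tendsto_log_div (G.ncard_circuits_mono ℓ) hc hpow hB

theorem HasEntropy.log_card_div_le [Finite E] {G : SerreGraph V E} {ℓ : G.LengthFunction} {h : ℝ}
    (hh : G.HasEntropy ℓ h) {N : ℕ} (hN : N ≠ 0) {T : ℝ} (hT : 0 < T)
    (hpow : ∀ k : ℕ, k ≠ 0 → N ^ k ≤ (G.circuits ℓ (k * T)).ncard) :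
    Real.log N / T ≤ h := by
  have hlim : Tendsto (fun k : ℕ => (k : ℝ) * T) atTop atTop :=
    tendsto_natCast_atTop_atTop.atTop_mul_const hT
  refine ge_of_tendsto (hh.comp hlim) ?_
  filter_upwards [eventually_ne_atTop 0] with k hk
  have hkpos : (0 : ℝ) < k := by exact_mod_cast Nat.pos_of_ne_zero hk
  have h1 : (N : ℝ) ^ k ≤ (G.circuits ℓ (k * T)).ncard := by exact_mod_cast hpow k hk
  have h2 := Real.log_le_log (by positivity) h1
  rw [Real.log_pow] at h2
  simp only [Function.comp]
  rw [le_div_iff₀ (by positivity)]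
  calc Real.log N / T * (k * T) = k * Real.log N := by field_simp
    _ ≤ _ := h2

/-! ### Circuits of subgraphs -/

theorem Subgraph.isCircuit_map_val {G : SerreGraph V E} (H : G.Subgraph) {γ : List H.edges} :
    G.IsCircuit (γ.map Subtype.val) ↔ H.toGraph.IsCircuit γ := by
  have hF : ∀ e f : H.edges, G.Follows e f ↔ H.toGraph.Follows e f := fun e f => by
    simp only [Follows, toGraph, Subtype.ext_iff, ne_eq]
  simp only [IsCircuit, List.isChain_map, ne_eq, List.map_eq_nil_iff, List.getLast_map,
    List.head_map, hF]

theorem Subgraph.image_circuits {G : SerreGraph V E} (H : G.Subgraph) (ℓ : G.LengthFunction)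
    (t : ℝ) : (fun γ : List H.edges => γ.map Subtype.val) '' H.toGraph.circuits (ℓ.restrict H) t =
      {γ | γ ∈ G.circuits ℓ t ∧ ∀ e ∈ γ, e ∈ H.edges} := by
  have hsum : ∀ γ : List H.edges, ((γ.map Subtype.val).map ℓ.len).sum =
      (γ.map (ℓ.restrict H).len).sum := fun γ => by
    rw [List.map_map]; rfl
  ext γ
  constructor
  · rintro ⟨γ, hγ, rfl⟩
    refine ⟨⟨H.isCircuit_map_val.2 hγ.1, (hsum γ).trans_le hγ.2⟩, ?_⟩
    intro e he
    obtain ⟨f, -, rfl⟩ := List.mem_map.1 he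
    exact f.2
  · rintro ⟨hγ, hmem⟩
    lift γ to List H.edges using hmem
    exact ⟨γ, ⟨H.isCircuit_map_val.1 hγ.1, (hsum γ).symm.trans_le hγ.2⟩, rfl⟩

theorem Subgraph.ncard_circuits {G : SerreGraph V E} (H : G.Subgraph) (ℓ : G.LengthFunction)
    (t : ℝ) : (H.toGraph.circuits (ℓ.restrict H) t).ncard =
      {γ | γ ∈ G.circuits ℓ t ∧ ∀ e ∈ γ, e ∈ H.edges}.ncard := by
  rw [← H.image_circuits ℓ t,
    Set.ncard_image_of_injective _ (List.map_injective_iff.2 Subtype.val_injective)]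

theorem Subgraph.ncard_circuits_le [Finite E] {G : SerreGraph V E} (H : G.Subgraph)
    (ℓ : G.LengthFunction) (t : ℝ) :
    (H.toGraph.circuits (ℓ.restrict H) t).ncard ≤ (G.circuits ℓ t).ncard := by
  rw [H.ncard_circuits]
  exact Set.ncard_le_ncard (fun γ hγ => hγ.1) (G.finite_circuits ℓ t)

/-- Every subgraph of a finite graph which has an entropy has an entropy. -/
theorem Subgraph.exists_hasEntropy [Finite E] {G : SerreGraph V E} (H : G.Subgraph)
    {ℓ : G.LengthFunction} {h : ℝ} (hh : G.HasEntropy ℓ h) :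
    ∃ h', H.toGraph.HasEntropy (ℓ.restrict H) h' := by
  -- The entropy of the ambient graph supplies the a priori upper bound.
  refine H.toGraph.exists_hasEntropy (ℓ.restrict H) (B := h + 1) ?_
  filter_upwards [(tendsto_order.1 hh).2 (h + 1) (by linarith), eventually_gt_atTop 0] with t ht h0
  refine le_trans (div_le_div_of_nonneg_right ?_ h0.le) ht.le
  rcases Nat.eq_zero_or_pos (H.toGraph.circuits (ℓ.restrict H) t).ncard with h1 | h1
  · rw [h1, Nat.cast_zero, Real.log_zero]
    exact Real.log_natCast_nonneg _
  · exact Real.log_le_log (by exact_mod_cast h1) (by exact_mod_cast H.ncard_circuits_le ℓ t)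


/-! ### Subsolutions of the transfer operator -/

open Classical in
/-- The directed edges which may follow `e`. -/
noncomputable def followers [Fintype E] (G : SerreGraph V E) (e : E) : Finset E :=
  {f | G.Follows e f}

theorem mem_followers [Fintype E] {G : SerreGraph V E} {e f : E} :
    f ∈ G.followers e ↔ G.Follows e f := by
  simp [followers]

/-- The partial sums of the weights `exp (-s * length)` over the nonbacktracking edge paths. -/
noncomputable def pathSum [Fintype E] (G : SerreGraph V E) (ℓ : G.LengthFunction) (s : ℝ) :
    ℕ → E → ℝ
  | 0, _ => 0
  | n + 1, e => 1 + Real.exp (-(s * ℓ.len e)) * ∑ f ∈ G.followers e, pathSum G ℓ s n f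

section pathSum

variable [Fintype E] (G : SerreGraph V E) (ℓ : G.LengthFunction) (s : ℝ)

theorem pathSum_succ (n : ℕ) (e : E) : G.pathSum ℓ s (n + 1) e =
    1 + Real.exp (-(s * ℓ.len e)) * ∑ f ∈ G.followers e, G.pathSum ℓ s n f := rfl

theorem pathSum_nonneg (n : ℕ) (e : E) : 0 ≤ G.pathSum ℓ s n e := by
  induction n generalizing e with
  | zero => exact le_rfl
  | succ n ih =>
    have := Finset.sum_nonneg fun f (_ : f ∈ G.followers e) => ih f
    rw [pathSum_succ]
    positivity

theorem pathSum_le_succ (n : ℕ) (e : E) : G.pathSum ℓ s n e ≤ G.pathSum ℓ s (n + 1) e := by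
  induction n generalizing e with
  | zero => exact G.pathSum_nonneg ℓ s 1 e
  | succ n ih =>
    rw [pathSum_succ, pathSum_succ]
    gcongr with f
    exact ih f

/-- The nonbacktracking edge paths of bounded length after a given edge. -/
def pathsFrom {G : SerreGraph V E} (ℓ : G.LengthFunction) (n : ℕ) (t : ℝ) (e : E) :
    Set (List E) :=
  {x | (e :: x).IsChain G.Follows ∧ x.length < n ∧ ((e :: x).map ℓ.len).sum ≤ t}

theorem finite_pathsFrom {G : SerreGraph V E} (ℓ : G.LengthFunction) (n : ℕ) (t : ℝ) (e : E) :
    (pathsFrom ℓ n t e).Finite :=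
  (ℓ.finite_sum_le t).subset fun x hx => by
    have h := hx.2.2
    rw [List.map_cons, List.sum_cons] at h
    exact (le_add_of_nonneg_left (ℓ.pos e).le).trans h

/-- A path of length at most t has weight at least exp(-st). In `pathSum` the last edge of a path
carries no weight, which only enlarges the sum. -/
theorem ncard_pathsFrom_le (hs : 0 ≤ s) (n : ℕ) (t : ℝ) (e : E) :
    ((pathsFrom ℓ n t e).ncard : ℝ) ≤ Real.exp (s * t) * G.pathSum ℓ s n e := by
  classical
  induction n generalizing t e with
  | zero =>
    have : pathsFrom ℓ 0 t e = ∅ := Set.eq_empty_of_forall_notMem fun x hx =>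
      absurd hx.2.1 (Nat.not_lt_zero _)
    simp [this, pathSum]
  | succ n ih =>
    by_cases ht : t < ℓ.len e
    · have : pathsFrom ℓ (n + 1) t e = ∅ := Set.eq_empty_of_forall_notMem fun x hx => by
        have h := hx.2.2
        rw [List.map_cons, List.sum_cons] at h
        linarith [ℓ.sum_nonneg x]
      rw [this, Set.ncard_empty, Nat.cast_zero]
      exact mul_nonneg (Real.exp_pos _).le (G.pathSum_nonneg ℓ s _ e)
    push Not at ht
    let P : E → Finset (List E) := fun f => (finite_pathsFrom ℓ n (t - ℓ.len e) f).toFinset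
    have hP : ∀ f, (P f).card = (pathsFrom ℓ n (t - ℓ.len e) f).ncard := fun f =>
      (Set.ncard_eq_toFinset_card _ _).symm
    have hsub : pathsFrom ℓ (n + 1) t e ⊆
        (({[]} ∪ (G.followers e).biUnion fun f => (P f).image (List.cons f) :
          Finset (List E)) : Set (List E)) := by
      rintro (_ | ⟨f, x⟩) hx
      · simp
      · obtain ⟨h1, h2, h3⟩ := hx
        rw [List.isChain_cons_cons] at h1
        simp only [Finset.coe_union, Finset.coe_biUnion, Set.mem_union, Set.mem_iUnion,
          Finset.mem_coe, Finset.mem_image]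
        refine Or.inr ⟨f, mem_followers.2 h1.1, x, ?_, rfl⟩
        simp only [P, Set.Finite.mem_toFinset]
        refine ⟨h1.2, by simpa using h2, ?_⟩
        rw [List.map_cons, List.sum_cons] at h3
        linarith
    have hcard : (pathsFrom ℓ (n + 1) t e).ncard ≤
        1 + ∑ f ∈ G.followers e, (pathsFrom ℓ n (t - ℓ.len e) f).ncard := by
      refine (Set.ncard_le_ncard hsub (Finset.finite_toSet _)).trans ?_
      rw [Set.ncard_coe_finset]
      refine (Finset.card_union_le _ _).trans ?_
      rw [Finset.card_singleton]
      refine Nat.add_le_add_left (Finset.card_biUnion_le.trans (Finset.sum_le_sum fun f _ => ?_)) _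
      exact Finset.card_image_le.trans (hP f).le
    calc ((pathsFrom ℓ (n + 1) t e).ncard : ℝ)
        ≤ 1 + ∑ f ∈ G.followers e, ((pathsFrom ℓ n (t - ℓ.len e) f).ncard : ℝ) := by
          exact_mod_cast hcard
      _ ≤ 1 + ∑ f ∈ G.followers e, Real.exp (s * (t - ℓ.len e)) * G.pathSum ℓ s n f := by
          gcongr with f
          exact ih _ _
      _ ≤ Real.exp (s * t) +
            ∑ f ∈ G.followers e, Real.exp (s * (t - ℓ.len e)) * G.pathSum ℓ s n f := by
          gcongr
          exact Real.one_le_exp (mul_nonneg hs ((ℓ.pos e).le.trans ht))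
      _ = _ := by
          rw [pathSum_succ, mul_add, mul_one, ← mul_assoc, ← Real.exp_add, Finset.mul_sum]
          ring_nf

theorem ncard_circuits_le_of_pathSum_le (hs : 0 ≤ s) {W : ℝ}
    (hW : ∀ n e, G.pathSum ℓ s n e ≤ W) (t : ℝ) :
    ((G.circuits ℓ t).ncard : ℝ) ≤ Fintype.card E * W * Real.exp (s * t) := by
  classical
  obtain ⟨ε, hε, hle⟩ := ℓ.exists_le_len
  set n := ⌊t / ε⌋₊ with hn
  let P : E → Finset (List E) := fun f => (finite_pathsFrom ℓ n t f).toFinset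
  have hP : ∀ f, (P f).card = (pathsFrom ℓ n t f).ncard := fun f =>
    (Set.ncard_eq_toFinset_card _ _).symm
  have hsub : G.circuits ℓ t ⊆
      ((Finset.univ.biUnion fun f => (P f).image (List.cons f) : Finset (List E)) :
        Set (List E)) := by
    rintro (_ | ⟨f, x⟩) hx
    · exact absurd rfl hx.1.1
    · obtain ⟨⟨_, h1, _⟩, h3⟩ := hx
      simp only [Finset.coe_biUnion, Set.mem_iUnion, Finset.mem_coe, Finset.mem_image]
      refine ⟨f, Finset.mem_univ _, x, ?_, rfl⟩
      simp only [P, Set.Finite.mem_toFinset]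
      refine ⟨h1, ?_, h3⟩
      have : (f :: x).length ≤ n := Nat.le_floor
        ((le_div_iff₀ hε).2 ((ℓ.length_mul_le hle (f :: x)).trans h3))
      simpa using this
  have hcard : (G.circuits ℓ t).ncard ≤ ∑ f, (pathsFrom ℓ n t f).ncard := by
    refine (Set.ncard_le_ncard hsub (Finset.finite_toSet _)).trans ?_
    rw [Set.ncard_coe_finset]
    exact Finset.card_biUnion_le.trans
      (Finset.sum_le_sum fun f _ => Finset.card_image_le.trans (hP f).le)
  calc ((G.circuits ℓ t).ncard : ℝ) ≤ ∑ f, ((pathsFrom ℓ n t f).ncard : ℝ) := by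
        exact_mod_cast hcard
    _ ≤ ∑ f : E, Real.exp (s * t) * W := by
        gcongr with f
        exact (G.ncard_pathsFrom_le ℓ s hs n t f).trans
          (mul_le_mul_of_nonneg_left (hW n f) (Real.exp_pos _).le)
    _ = _ := by
        rw [Finset.sum_const, Finset.card_univ, nsmul_eq_mul]
        ring

variable {G ℓ s}

/-- Bounded path sums allow only O(exp(st)) circuits of length at most t. -/
theorem HasEntropy.le_of_pathSum_le {h : ℝ} (hh : G.HasEntropy ℓ h) (hs : 0 ≤ s) {W : ℝ}
    (hW : ∀ n e, G.pathSum ℓ s n e ≤ W) : h ≤ s := by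
  set c : ℝ := max (Fintype.card E * W) 1 with hc
  have hc1 : 1 ≤ c := le_max_right _ _
  have hlim : Tendsto (fun t : ℝ => Real.log c / t + s) atTop (𝓝 (0 + s)) :=
    (tendsto_const_nhds.div_atTop tendsto_id).add_const s
  rw [zero_add] at hlim
  refine le_of_tendsto_of_tendsto hh hlim ?_
  filter_upwards [eventually_gt_atTop 0] with t ht
  rw [div_add' _ _ _ ht.ne']
  refine div_le_div_of_nonneg_right ?_ ht.le
  rcases Nat.eq_zero_or_pos (G.circuits ℓ t).ncard with h0 | h0
  · rw [h0, Nat.cast_zero, Real.log_zero]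
    exact add_nonneg (Real.log_nonneg hc1) (mul_nonneg hs ht.le)
  · have h1 := G.ncard_circuits_le_of_pathSum_le ℓ s hs hW t
    have h2 : ((G.circuits ℓ t).ncard : ℝ) ≤ c * Real.exp (s * t) :=
      h1.trans (mul_le_mul_of_nonneg_right (le_max_left _ _) (Real.exp_pos _).le)
    have h3 := Real.log_le_log (by exact_mod_cast h0) h2
    rwa [Real.log_mul (by linarith) (Real.exp_pos _).ne', Real.log_exp] at h3

/-- If the entropy is greater than `s`, then the transfer operator with exponent `s` has a
normalized nonnegative subsolution. -/
theorem HasEntropy.exists_subsolution {h : ℝ} (hh : G.HasEntropy ℓ h) (hs : 0 ≤ s) (hsh : s < h) :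
    ∃ w : E → ℝ, (∀ e, 0 ≤ w e) ∧ (∀ e, w e ≤ 1) ∧ (∃ e, w e = 1) ∧
      ∀ e, w e ≤ Real.exp (-(s * ℓ.len e)) * ∑ f ∈ G.followers e, w f := by
  have hunb : ∀ W : ℝ, ∃ n e, W < G.pathSum ℓ s n e := by
    by_contra! hcon
    obtain ⟨W, hW⟩ := hcon
    exact absurd (hh.le_of_pathSum_le hs hW) (not_le.2 hsh)
  have : Nonempty E := by
    obtain ⟨_, e, _⟩ := hunb 0
    exact ⟨e⟩
  choose m hm using fun n => Finite.exists_max (G.pathSum ℓ s n)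
  choose N e hN using fun j : ℕ => hunb (j + 1)
  set M : ℕ → ℝ := fun j => G.pathSum ℓ s (N j) (m (N j)) with hMdef
  have hM : ∀ j : ℕ, (j : ℝ) + 1 < M j := fun j => (hN j).trans_le (hm _ _)
  have hM0 : ∀ j, 0 < M j := fun j => lt_trans (by positivity) (hM j)
  -- The path sums, scaled to maximum 1, lie in a compact cube; the subsolution is a limit point.
  set x : ℕ → E → ℝ := fun j f => G.pathSum ℓ s (N j) f / M j with hx
  have hx01 : ∀ j, x j ∈ Set.Icc (0 : E → ℝ) 1 := fun j =>
    ⟨fun f => div_nonneg (G.pathSum_nonneg ℓ s _ f) (hM0 j).le,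
      fun f => (div_le_one (hM0 j)).2 (hm _ f)⟩
  obtain ⟨w, hw, φ, hφ, hlim⟩ := isCompact_Icc.tendsto_subseq hx01
  have hlimf : ∀ f, Tendsto (fun j => x (φ j) f) atTop (𝓝 (w f)) := fun f =>
    (tendsto_pi_nhds.1 hlim) f
  have hMinv : Tendsto (fun j => 1 / M (φ j)) atTop (𝓝 0) := by
    have : Tendsto (fun j => M (φ j)) atTop atTop := by
      refine tendsto_atTop_mono (fun j => ?_) (tendsto_natCast_atTop_atTop (R := ℝ))
      have h1 : (j : ℝ) ≤ φ j := by exact_mod_cast hφ.id_le j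
      linarith [hM (φ j)]
    exact tendsto_const_nhds.div_atTop this
  refine ⟨w, fun f => hw.1 f, fun f => hw.2 f, ?_, fun f => ?_⟩
  · have hsup : ∀ j, ∃ f, x (φ j) f = 1 := fun j => ⟨m (N (φ j)), div_self (hM0 _).ne'⟩
    choose a ha using hsup
    -- One of the finitely many edges attains the maximum infinitely often, so the value 1 survives
    -- in the limit.
    obtain ⟨f, hf⟩ := Finite.exists_infinite_fiber a
    have hfr : ∃ᶠ j in atTop, x (φ j) f = 1 := by
      rw [Nat.frequently_atTop_iff_infinite]
      refine (Set.infinite_coe_iff.1 hf).mono fun j hj => ?_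
      have : a j = f := hj
      exact this ▸ ha j
    refine ⟨f, ?_⟩
    by_contra hne
    exact hfr ((hlimf f).eventually_ne hne)
  -- Divided by M, the inhomogeneous term 1 of the recursion vanishes in the limit; monotonicity in
  -- the number of steps gives the inequality.
  · have hlim2 : Tendsto (fun j => 1 / M (φ j) + Real.exp (-(s * ℓ.len f)) *
        ∑ g ∈ G.followers f, x (φ j) g) atTop
        (𝓝 (0 + Real.exp (-(s * ℓ.len f)) * ∑ g ∈ G.followers f, w g)) :=
      hMinv.add (tendsto_const_nhds.mul (tendsto_finsetSum _ fun g _ => hlimf g))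
    rw [zero_add] at hlim2
    refine le_of_tendsto_of_tendsto' (hlimf f) hlim2 fun j => ?_
    simp only [hx]
    rw [← Finset.sum_div, ← mul_div_assoc, ← add_div, ← pathSum_succ]
    exact div_le_div_of_nonneg_right (G.pathSum_le_succ ℓ s _ f) (hM0 _).le

end pathSum


/-! ### The Euler characteristic -/

theorem exists_orientation [Finite E] (G : SerreGraph V E) :
    ∃ O : Set E, ∀ e, G.bar e ∈ O ↔ e ∉ O := by
  obtain ⟨n, ⟨φ⟩⟩ := Finite.exists_equiv_fin E
  refine ⟨{e | φ e < φ (G.bar e)}, fun e => ?_⟩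
  have hne : φ e ≠ φ (G.bar e) := fun h => G.bar_ne e (φ.injective h).symm
  simp only [Set.mem_ofPred_eq, G.bar_bar, not_lt]
  exact ⟨le_of_lt, fun h => lt_of_le_of_ne h hne.symm⟩

/-- Real valued cochains: the functions on the directed edges which change sign under reversal. -/
def cochains (G : SerreGraph V E) : Submodule ℝ (E → ℝ) where
  carrier := {f | ∀ e, f (G.bar e) = -f e}
  add_mem' := by
    intro f g hf hg e
    simp only [Pi.add_apply, hf e, hg e]
    ring
  zero_mem' := fun e => by simp
  smul_mem' := by
    intro c f hf e
    simp only [Pi.smul_apply, hf e, smul_eq_mul]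
    ring

/-- A cochain is determined by arbitrary values on an orientation, which contains half of the
directed edges. -/
theorem two_mul_finrank_cochains [Fintype E] (G : SerreGraph V E) :
    2 * Module.finrank ℝ G.cochains = Fintype.card E := by
  classical
  obtain ⟨O, hO⟩ := G.exists_orientation
  let Φ : G.cochains ≃ₗ[ℝ] (O → ℝ) :=
    { toFun := fun f e => f.1 e
      map_add' := fun _ _ => rfl
      map_smul' := fun _ _ => rfl
      invFun := fun f => ⟨fun e => if h : e ∈ O then f ⟨e, h⟩ else
          -f ⟨G.bar e, (hO e).2 h⟩, fun e => by
            by_cases h : e ∈ O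
            · have h' : G.bar e ∉ O := fun h' => (hO e).1 h' h
              simp only [h, h', dite_true, dite_false, G.bar_bar]
            · have h' : G.bar e ∈ O := (hO e).2 h
              simp only [h, h', dite_true, dite_false, neg_neg]⟩
      left_inv := fun f => by
        refine Subtype.ext (funext fun e => ?_)
        by_cases h : e ∈ O
        · simp only [h, dite_true]
        · simp only [h, dite_false, f.2 e, neg_neg]
      right_inv := fun f => by
        funext e
        simp only [e.2, dite_true, Subtype.coe_eta] }
  rw [Φ.finrank_eq, Module.finrank_fintype_fun_eq_card]
  have h1 : Fintype.card O = Fintype.card (Oᶜ : Set E) :=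
    Fintype.card_congr
      { toFun := fun e => ⟨G.bar e, fun h => (hO e).1 h e.2⟩
        invFun := fun e => ⟨G.bar e, (hO e).2 e.2⟩
        left_inv := fun e => Subtype.ext (G.bar_bar e)
        right_inv := fun e => Subtype.ext (G.bar_bar e) }
  have h2 := Fintype.card_compl_set O
  have h3 := set_fintype_card_le_univ O
  omega

/-- The coboundary of a function on the vertices. -/
def coboundary (G : SerreGraph V E) : (V → ℝ) →ₗ[ℝ] G.cochains where
  toFun g := ⟨fun e => g (G.τ e) - g (G.o e), fun e => by
    simp only [G.τ_bar, G.o_bar, neg_sub]⟩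
  map_add' _ _ := Subtype.ext (funext fun _ => add_sub_add_comm _ _ _ _)
  map_smul' _ _ := Subtype.ext (funext fun _ => (mul_sub _ _ _).symm)

theorem IsWalk.eq_of_coboundary_eq_zero {G : SerreGraph V E} {g : V → ℝ}
    (hg : G.coboundary g = 0) {p : List E} {a b : V} (hp : G.IsWalk a p b) : g a = g b := by
  induction p generalizing a with
  | nil => rw [show a = b from hp]
  | cons e p ih =>
    rw [← ih hp.2, ← hp.1]
    have h := congrFun (congrArg Subtype.val hg) e
    exact (sub_eq_zero.1 h).symm

theorem finrank_ker_coboundary {G : SerreGraph V E} [Finite V] (hG : G.Connected) :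
    Module.finrank ℝ (LinearMap.ker G.coboundary) = 1 := by
  obtain ⟨⟨x⟩, hc⟩ := hG
  have hone : (1 : V → ℝ) ∈ LinearMap.ker G.coboundary :=
    LinearMap.mem_ker.2 (Subtype.ext (funext fun e => sub_self _))
  refine finrank_eq_one (⟨1, hone⟩ : LinearMap.ker G.coboundary) ?_ ?_
  · intro h
    have := congrFun (congrArg Subtype.val h) x
    simp at this
  · rintro ⟨g, hg⟩
    refine ⟨g x, Subtype.ext (funext fun y => ?_)⟩
    obtain ⟨p, hp⟩ := hc x y
    have := hp.eq_of_coboundary_eq_zero (LinearMap.mem_ker.1 hg)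
    simpa using this

/-- The integral of a cochain, as a homomorphism on the edge group. -/
noncomputable def integral (G : SerreGraph V E) (f : G.cochains) :
    G.EdgeGroup →* Multiplicative ℝ :=
  PresentedGroup.toGroup (f := fun e => Multiplicative.ofAdd (f.1 e)) <| by
    rintro _ ⟨e, rfl⟩
    rw [map_mul, FreeGroup.lift_apply_of, FreeGroup.lift_apply_of, f.2 e, ofAdd_neg,
      mul_inv_cancel]

theorem integral_of (G : SerreGraph V E) (f : G.cochains) (e : E) :
    G.integral f (PresentedGroup.of e) = Multiplicative.ofAdd (f.1 e) :=
  PresentedGroup.toGroup.of _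

theorem integral_word_cons (G : SerreGraph V E) (f : G.cochains) (e : E) (p : List E) :
    (G.integral f (G.word (e :: p))).toAdd = f.1 e + (G.integral f (G.word p)).toAdd := by
  rw [word, List.map_cons, List.prod_cons, map_mul, integral_of]
  rfl

theorem integral_add (G : SerreGraph V E) (f g : G.cochains) :
    G.integral (f + g) = G.integral f * G.integral g := by
  refine PresentedGroup.ext fun e => ?_
  rw [MonoidHom.mul_apply, integral_of, integral_of, integral_of]
  rfl

theorem integral_smul (G : SerreGraph V E) (c : ℝ) (f : G.cochains) (x : G.EdgeGroup) :
    (G.integral (c • f) x).toAdd = c * (G.integral f x).toAdd := by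
  let ψ : G.EdgeGroup →* Multiplicative ℝ :=
    (AddMonoidHom.toMultiplicative (AddMonoidHom.mulLeft c)).comp (G.integral f)
  have h : G.integral (c • f) = ψ := by
    refine PresentedGroup.ext fun e => ?_
    rw [MonoidHom.comp_apply, integral_of, integral_of]
    rfl
  rw [h]
  rfl

/-- A cochain with vanishing integral over all closed walks at `x` is a coboundary. -/
theorem mem_range_coboundary {G : SerreGraph V E} (hG : G.Connected) (x : V) {f : G.cochains}
    (hf : ∀ g ∈ G.fundamentalGroup x, G.integral f g = 1) :
    f ∈ LinearMap.range G.coboundary := by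
  choose P hP using hG.2 x
  refine ⟨fun y => (G.integral f (G.word (P y))).toAdd, Subtype.ext (funext fun e => ?_)⟩
  -- The potential is the integral along the chosen paths from `x`; the closed walk through `e`
  -- shows that its coboundary is `f`.
  have hw : G.IsWalk x (P (G.o e) ++ ([e] ++ ((P (G.τ e)).map G.bar).reverse)) x :=
    (hP _).append (IsWalk.append (b := G.τ e) ⟨rfl, rfl⟩ (hP _).reverse)
  have h := congrArg Multiplicative.toAdd (hf _ ⟨_, hw, rfl⟩)
  rw [word_append, word_append, word_reverse, MonoidHom.map_mul, MonoidHom.map_mul, MonoidHom.map_inv, toAdd_mul, toAdd_mul,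
    toAdd_inv, integral_word_cons] at h
  have h0 : (G.integral f (G.word [])).toAdd = 0 := by simp [word]
  rw [h0, toAdd_one] at h
  change (G.integral f (G.word (P (G.τ e)))).toAdd - (G.integral f (G.word (P (G.o e)))).toAdd
    = f.1 e
  linarith

/-- Every real valued homomorphism on the fundamental group is the integral of a cochain. -/
theorem exists_integral_eq {G : SerreGraph V E} (hG : G.Connected) (x : V)
    (χ : G.fundamentalGroup x →* Multiplicative ℝ) :
    ∃ f : G.cochains, ∀ g : G.fundamentalGroup x, G.integral f g = χ g := by
  choose P hP using hG.2 x
  -- Walks are closed up by the chosen paths from `x`; the cochain is the value of `χ` on closed-up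
  -- edges.
  let lp : ∀ (a b : V) (p : List E), G.IsWalk a p b → G.fundamentalGroup x := fun a b p hp =>
    ⟨G.word (P a) * G.word p * (G.word (P b))⁻¹, P a ++ p ++ ((P b).map G.bar).reverse,
      ((hP a).append hp).append (hP b).reverse, by
        rw [word_append, word_append, word_reverse]⟩
  have hlp : ∀ (a b c : V) (p q : List E) (hp : G.IsWalk a p b) (hq : G.IsWalk b q c),
      lp a c (p ++ q) (hp.append hq) = lp a b p hp * lp b c q hq := by
    intro a b c p q hp hq
    refine Subtype.ext ?_
    simp only [lp, Subgroup.coe_mul, word_append]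
    group
  have hbar : ∀ e, χ (lp (G.o (G.bar e)) (G.τ (G.bar e)) [G.bar e] ⟨rfl, rfl⟩) =
      (χ (lp (G.o e) (G.τ e) [e] ⟨rfl, rfl⟩))⁻¹ := by
    intro e
    rw [← map_inv]
    congr 1
    refine Subtype.ext ?_
    simp only [lp, Subgroup.coe_inv, word, List.map_cons, List.map_nil, List.prod_cons,
      List.prod_nil, mul_one, of_bar, G.o_bar, G.τ_bar]
    group
  let f : G.cochains := ⟨fun e => (χ (lp (G.o e) (G.τ e) [e] ⟨rfl, rfl⟩)).toAdd, fun e => by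
    exact congrArg Multiplicative.toAdd (hbar e)⟩
  have hint : ∀ (p : List E) (a b : V) (hp : G.IsWalk a p b),
      G.integral f (G.word p) = χ (lp a b p hp) := by
    intro p
    induction p with
    | nil =>
      intro a b hp
      have hab : a = b := hp
      subst hab
      have : lp a a [] hp = 1 := Subtype.ext (by simp [lp, word])
      rw [this, map_one]
      simp [word]
    | cons e p ih =>
      intro a b hp
      obtain ⟨rfl, hp'⟩ := hp
      have h1 := hlp (G.o e) (G.τ e) b [e] p ⟨rfl, rfl⟩ hp'
      change lp (G.o e) b (e :: p) ⟨rfl, hp'⟩ = _ at h1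
      rw [h1, map_mul, ← ih _ _ hp', word, List.map_cons, List.prod_cons, map_mul, integral_of]
      rfl
  refine ⟨f, ?_⟩
  rintro ⟨_, p, hp, rfl⟩
  rw [hint p x x hp]
  -- The chosen path from `x` to itself need not be constant, so closing up conjugates; this is
  -- invisible in a commutative target.
  have h2 : lp x x p hp = ⟨G.word (P x), P x, hP x, rfl⟩ * ⟨G.word p, p, hp, rfl⟩ *
      (⟨G.word (P x), P x, hP x, rfl⟩ : G.fundamentalGroup x)⁻¹ := rfl
  rw [h2, map_mul, map_mul, map_inv, mul_comm (χ _) (χ _), mul_assoc, mul_inv_cancel, mul_one]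

/-- Rank-nullity twice. The cochains have dimension |E|/2; integration over free generators maps
them onto ℝ^r with the coboundaries as kernel, and these have dimension |V| - 1. -/
theorem card_edges_eq {G : SerreGraph V E} [Fintype V] [Fintype E] (hG : G.Connected) {r : ℕ}
    (hr : G.HasRank r) : Fintype.card E + 2 = 2 * Fintype.card V + 2 * r := by
  obtain ⟨x⟩ := hG.1
  obtain ⟨ψ⟩ := hr x
  let Φ : G.cochains →ₗ[ℝ] (Fin r → ℝ) :=
    { toFun := fun f i => (G.integral f (ψ.symm (FreeGroup.of i) : G.EdgeGroup)).toAdd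
      map_add' := fun f g => funext fun i => by rw [integral_add]; rfl
      map_smul' := fun c f => funext fun i => integral_smul G c f _ }
  have hsurj : LinearMap.range Φ = ⊤ := by
    refine LinearMap.range_eq_top.2 fun c => ?_
    obtain ⟨f, hf⟩ := exists_integral_eq hG x
      ((FreeGroup.lift fun i => Multiplicative.ofAdd (c i)).comp ψ.toMonoidHom)
    refine ⟨f, funext fun i => ?_⟩
    change (G.integral f _).toAdd = _
    rw [hf]
    simp
  have hker : LinearMap.ker Φ = LinearMap.range G.coboundary := by
    refine le_antisymm (fun f hf => mem_range_coboundary hG x fun g hg => ?_) ?_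
    · have h1 : ((G.integral f).comp (G.fundamentalGroup x).subtype).comp
          ψ.symm.toMonoidHom = 1 := FreeGroup.ext_hom _ _ fun i =>
        Multiplicative.toAdd.injective (congrFun (LinearMap.mem_ker.1 hf) i)
      have h2 := DFunLike.congr_fun h1 (ψ ⟨g, hg⟩)
      simpa using h2
    · rintro _ ⟨g, rfl⟩
      have hw : ∀ (p : List E) (a b : V), G.IsWalk a p b →
          (G.integral (G.coboundary g) (G.word p)).toAdd = g b - g a := by
        intro p
        induction p with
        | nil =>
          intro a b hp
          rw [show a = b from hp]
          simp [word]
        | cons e p ih =>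
          rintro a b ⟨rfl, hp⟩
          rw [integral_word_cons, ih _ _ hp]
          change g (G.τ e) - g (G.o e) + _ = _
          ring
      refine LinearMap.mem_ker.2 (funext fun i => ?_)
      obtain ⟨p, hp, hpe⟩ := (ψ.symm (FreeGroup.of i)).2
      change (G.integral (G.coboundary g) _).toAdd = 0
      rw [← hpe, hw p x x hp, sub_self]
  have h1 := LinearMap.finrank_range_add_finrank_ker Φ
  have h2 := LinearMap.finrank_range_add_finrank_ker G.coboundary
  rw [hsurj, finrank_top, hker, Module.finrank_fintype_fun_eq_card, Fintype.card_fin] at h1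
  rw [finrank_ker_coboundary hG, Module.finrank_fintype_fun_eq_card] at h2
  have h3 := G.two_mul_finrank_cochains
  omega


/-! ### Edges without followers -/

theorem IsCircuit.exists_follows {G : SerreGraph V E} {γ : List E} (hγ : G.IsCircuit γ) {e : E}
    (he : e ∈ γ) : (∃ f, G.Follows e f) ∧ ∃ f, G.Follows f e := by
  obtain ⟨-, z, hz⟩ := isCircuit_iff.1 hγ
  have key : ∀ (x : List E) (a b : E), G.Trail a x b → ∀ e ∈ x,
      (∃ f, G.Follows f e) ∧ (e = b ∨ ∃ f, G.Follows e f) := by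
    intro x
    induction x with
    | nil => simp
    | cons c x ih =>
      intro a b h e he
      rcases List.mem_cons.1 he with rfl | he
      · refine ⟨⟨a, h.1⟩, ?_⟩
        cases x with
        | nil => exact Or.inl h.2
        | cons d x => exact Or.inr ⟨d, h.2.1⟩
      · exact ih _ _ h.2 e he
  obtain ⟨h1, h2⟩ := key γ z z hz e he
  refine ⟨?_, h1⟩
  rcases h2 with rfl | h2
  · cases γ with
    | nil => simp at he
    | cons d x => exact ⟨d, hz.1⟩
  · exact h2

/-- Removing an edge which has no follower does not change the entropy. -/
theorem HasEntropy.exists_isProper {G : SerreGraph V E} {ℓ : G.LengthFunction} {h : ℝ}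
    (hh : G.HasEntropy ℓ h) {e : E} (he : ∀ f, ¬ G.Follows e f) :
    ∃ H : G.Subgraph, H.IsProper ∧ H.toGraph.HasEntropy (ℓ.restrict H) h := by
  let H : G.Subgraph :=
    { verts := Set.univ
      edges := {f | f ≠ e ∧ f ≠ G.bar e}
      bar_mem := fun f hf => ⟨fun h' => hf.2 (by rw [← h', G.bar_bar]),
        fun h' => hf.1 (by rw [← G.bar_bar f, h', G.bar_bar])⟩
      o_mem := fun _ _ => Set.mem_univ _ }
  refine ⟨H, fun hH => ?_, ?_⟩
  · have : e ∈ H.edges := hH.2 ▸ Set.mem_univ e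
    exact this.1 rfl
  · have hcount : ∀ t, (H.toGraph.circuits (ℓ.restrict H) t).ncard =
        (G.circuits ℓ t).ncard := by
      intro t
      rw [H.ncard_circuits]
      congr 1
      refine Set.Subset.antisymm (fun γ hγ => hγ.1) fun γ hγ => ⟨hγ, fun f hf => ⟨?_, ?_⟩⟩
      · rintro rfl
        obtain ⟨⟨g, hg⟩, -⟩ := hγ.1.exists_follows hf
        exact he g hg
      · rintro rfl
        obtain ⟨-, g, hg⟩ := hγ.1.exists_follows hf
        -- A predecessor of `bar e` reverses to a follower of `e`.
        have := follows_bar hg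
        rw [G.bar_bar] at this
        exact he _ this
    unfold HasEntropy
    simp only [hcount]
    exact hh

/-! ### Counting branches -/

open Classical in
/-- The directed edges with a given origin. -/
noncomputable def star [Fintype E] (G : SerreGraph V E) (x : V) : Finset E :=
  {e | G.o e = x}

theorem mem_star [Fintype E] {G : SerreGraph V E} {e : E} {x : V} : e ∈ G.star x ↔ G.o e = x := by
  simp [star]

theorem card_followers_add_one [Fintype E] (G : SerreGraph V E) (e : E) :
    (G.followers e).card + 1 = (G.star (G.τ e)).card := by
  classical
  have h : G.followers e = (G.star (G.τ e)).erase (G.bar e) := by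
    ext f
    rw [mem_followers, Finset.mem_erase, mem_star, Follows]
    constructor
    · rintro ⟨h1, h2⟩
      exact ⟨fun h' => h2 (by rw [h', G.bar_bar]), h1.symm⟩
    · rintro ⟨h1, h2⟩
      exact ⟨h2.symm, fun h' => h1 (by rw [h', G.bar_bar])⟩
  rw [h, Finset.card_erase_add_one (mem_star.2 (G.o_bar e))]

theorem two_le_card_star [Fintype E] {G : SerreGraph V E} (hG : G.Connected) [Nonempty E]
    (hfol : ∀ e, ∃ f, G.Follows e f) (x : V) : 2 ≤ (G.star x).card := by
  obtain ⟨f, rfl⟩ : ∃ f, G.o f = x := by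
    obtain ⟨p, hp⟩ := hG.2 x (G.o (Classical.arbitrary E))
    cases p with
    | nil => exact ⟨_, hp.symm⟩
    | cons f p => exact ⟨f, hp.1⟩
  have h := G.card_followers_add_one (G.bar f)
  rw [G.τ_bar] at h
  obtain ⟨g, hg⟩ := hfol (G.bar f)
  have := Finset.card_pos.2 ⟨g, mem_followers.2 hg⟩
  omega

/-- Each summand is deg - 2 at the terminus of the edge. The excesses deg - 2 of the vertices are
nonnegative and add up to n, so every degree is at most n + 2, and the sum over edges is Σ deg (deg
- 2). -/
theorem sum_card_followers_sub_one_le [Fintype V] [Fintype E] {G : SerreGraph V E}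
    (hG : G.Connected) (hfol : ∀ e, ∃ f, G.Follows e f) {n : ℕ}
    (hn : Fintype.card E = 2 * Fintype.card V + n) :
    ∑ e, ((G.followers e).card - 1) ≤ n * (n + 2) := by
  classical
  have hV : Nonempty V := hG.1
  have : Nonempty E := by
    rw [← Fintype.card_pos_iff, hn]
    have := Fintype.card_pos (α := V)
    omega
  have h2 := two_le_card_star hG hfol
  have hfib : ∀ F : V → ℕ, ∑ e, F (G.o e) = ∑ x, (G.star x).card * F x := by
    intro F
    rw [← Finset.sum_fiberwise_of_maps_to (s := Finset.univ) (t := Finset.univ)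
      (g := G.o) (fun _ _ => Finset.mem_univ _)]
    refine Finset.sum_congr rfl fun x _ => ?_
    rw [Finset.sum_congr rfl (g := fun _ => F x) (fun e he => by
      rw [(Finset.mem_filter.1 he).2]), Finset.sum_const, smul_eq_mul]
    congr 2
  have hsum : ∑ x, ((G.star x).card - 2) = n := by
    have h3 : Fintype.card E = ∑ x, (G.star x).card := by
      simpa using hfib fun _ => 1
    have h4 : ∑ x, (G.star x).card = ∑ x, ((G.star x).card - 2) + ∑ _x : V, 2 := by
      rw [← Finset.sum_add_distrib]
      exact Finset.sum_congr rfl fun x _ => by have := h2 x; omega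
    rw [Finset.sum_const, Finset.card_univ, smul_eq_mul] at h4
    omega
  have hle : ∀ x, (G.star x).card ≤ n + 2 := fun x => by
    have := Finset.single_le_sum (f := fun x => (G.star x).card - 2) (fun _ _ => Nat.zero_le _)
      (Finset.mem_univ x)
    omega
  calc ∑ e, ((G.followers e).card - 1) = ∑ e, ((G.star (G.τ e)).card - 2) :=
        Finset.sum_congr rfl fun e _ => by
          have := G.card_followers_add_one e
          omega
    _ = ∑ e, ((G.star (G.o e)).card - 2) :=
        Fintype.sum_equiv ⟨G.bar, G.bar, G.bar_bar, G.bar_bar⟩ _ _ fun e => by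
          rw [Equiv.coe_fn_mk, G.o_bar]
    _ = ∑ x, (G.star x).card * ((G.star x).card - 2) :=
        hfib fun x => (G.star x).card - 2
    _ ≤ ∑ x, (n + 2) * ((G.star x).card - 2) :=
        Finset.sum_le_sum fun x _ => Nat.mul_le_mul_right _ (hle x)
    _ = n * (n + 2) := by rw [← Finset.mul_sum, hsum, mul_comm]

/-! ### Free pairs of loops -/

/-- After cancelling common copies, unequal exponents would compare a word starting with `a` to one
starting with `b`. -/
theorem eq_of_replicate_append_prefix {α : Type*} {a b : α} (hab : a ≠ b) {x y : List α}
    {i j : ℕ} (h : (List.replicate i (a :: x)).flatten ++ (b :: y) <+: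
      (List.replicate j (a :: x)).flatten ++ (b :: y)) : i = j := by
  induction i generalizing j with
  | zero =>
    cases j with
    | zero => rfl
    | succ j =>
      simp only [List.replicate_zero, List.flatten_nil, List.nil_append, List.replicate_succ,
        List.flatten_cons, List.cons_append, List.cons_prefix_cons] at h
      exact absurd h.1.symm hab
  | succ i ih =>
    cases j with
    | zero =>
      simp only [List.replicate_zero, List.flatten_nil, List.nil_append, List.replicate_succ,
        List.flatten_cons, List.cons_append, List.cons_prefix_cons] at h
      exact absurd h.1 hab
    | succ j =>
      rw [List.replicate_succ, List.replicate_succ, List.flatten_cons, List.flatten_cons,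
        List.append_assoc, List.append_assoc, List.prefix_append_right_inj] at h
      rw [ih h]

/-- Two loops at the edge `z` with different first edges force the entropy to be positive. -/
theorem HasEntropy.log_div_le_of_trail [Finite E] {G : SerreGraph V E} {ℓ : G.LengthFunction}
    {h : ℝ} (hh : G.HasEntropy ℓ h) {z a b : E} {x y : List E} (hab : a ≠ b)
    (hx : G.Trail z (a :: x) z) (hy : G.Trail z (b :: y) z) {N : ℕ} (hN : N ≠ 0) :
    Real.log N / (N * ((a :: x).map ℓ.len).sum + ((b :: y).map ℓ.len).sum) ≤ h := by
  classical
  set A := ((a :: x).map ℓ.len).sum with hA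
  set B := ((b :: y).map ℓ.len).sum with hB
  have hA0 : 0 ≤ A := ℓ.sum_nonneg _
  have hB0 : 0 < B := by
    rw [hB, List.map_cons, List.sum_cons]
    exact add_pos_of_pos_of_nonneg (ℓ.pos b) (ℓ.sum_nonneg y)
  let W : ℕ → List E := fun i => (List.replicate i (a :: x)).flatten ++ (b :: y)
  have hWinj : Function.Injective W := fun i j hij =>
    eq_of_replicate_append_prefix hab (show W i <+: W j from hij ▸ List.prefix_rfl)
  have hsum : ∀ i, ((W i).map ℓ.len).sum = i * A + B := by
    intro i
    induction i with
    | zero => simp [W, hB]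
    | succ i ih =>
      have h1 : W (i + 1) = (a :: x) ++ W i := by
        simp only [W, List.replicate_succ, List.flatten_cons, List.append_assoc]
      rw [h1, List.map_append, List.sum_append, ih, ← hA]
      push_cast
      ring
  refine hh.log_card_div_le hN (by positivity) fun k hk => ?_
  have key := G.card_pow_le_ncard_circuits ℓ (z := z) (S := (Finset.range N).image W)
    (T := N * A + B) ?_ ?_ ?_ ?_ hk
  · rwa [Finset.card_image_of_injective _ hWinj, Finset.card_range] at key
  · intro u hu
    obtain ⟨i, -, rfl⟩ := Finset.mem_image.1 hu
    simp [W]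
  · intro u hu
    obtain ⟨i, -, rfl⟩ := Finset.mem_image.1 hu
    exact (Trail.flatten fun u hu => List.eq_of_mem_replicate hu ▸ hx).append hy
  · intro u hu v hv huv
    obtain ⟨i, -, rfl⟩ := Finset.mem_image.1 hu
    obtain ⟨j, -, rfl⟩ := Finset.mem_image.1 hv
    rw [eq_of_replicate_append_prefix hab huv]
  · intro u hu
    obtain ⟨i, hi, rfl⟩ := Finset.mem_image.1 hu
    rw [hsum]
    have : (i : ℝ) ≤ N := by exact_mod_cast (Finset.mem_range.1 hi).le
    nlinarith

theorem Subgraph.trail_map_val {G : SerreGraph V E} (H : G.Subgraph) {z w : H.edges}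
    {x : List H.edges} : G.Trail z (x.map Subtype.val) w ↔ H.toGraph.Trail z x w := by
  induction x generalizing z with
  | nil => simp [Trail, Subtype.ext_iff]
  | cons e x ih =>
    rw [List.map_cons, Trail, Trail, ih]
    simp only [Follows, toGraph, Subtype.ext_iff, ne_eq]

theorem Subgraph.log_div_le_of_trail [Finite E] {G : SerreGraph V E} (H : G.Subgraph)
    {ℓ : G.LengthFunction} {h : ℝ} (hh : H.toGraph.HasEntropy (ℓ.restrict H) h) {z a b : E}
    {x y : List E} (hab : a ≠ b) (hx : G.Trail z (a :: x) z) (hy : G.Trail z (b :: y) z)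
    (hz : z ∈ H.edges) (hxH : ∀ e ∈ a :: x, e ∈ H.edges) (hyH : ∀ e ∈ b :: y, e ∈ H.edges)
    {N : ℕ} (hN : N ≠ 0) :
    Real.log N / (N * ((a :: x).map ℓ.len).sum + ((b :: y).map ℓ.len).sum) ≤ h := by
  lift z to H.edges using hz
  obtain ⟨haH, hxH'⟩ := List.forall_mem_cons.1 hxH
  obtain ⟨hbH, hyH'⟩ := List.forall_mem_cons.1 hyH
  lift a to H.edges using haH
  lift b to H.edges using hbH
  lift x to List H.edges using hxH'
  lift y to List H.edges using hyH'
  have key := hh.log_div_le_of_trail (fun h => hab (congrArg Subtype.val h))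
    (H.trail_map_val (x := a :: x).1 hx) (H.trail_map_val (x := b :: y).1 hy) hN
  have hsum : ∀ u : List H.edges, ((u.map Subtype.val).map ℓ.len).sum =
      (u.map (ℓ.restrict H).len).sum := fun u => by
    rw [List.map_map]; rfl
  rwa [← hsum, ← hsum] at key


/-! ### Following a choice of followers -/

theorem trail_iterate {G : SerreGraph V E} {σ : E → E} (hσ : ∀ e, G.Follows e (σ e)) {z b : E}
    (hz : G.Follows z b) (m : ℕ) : G.Trail z (List.iterate σ b (m + 1)) (σ^[m] b) := by
  induction m generalizing z b with
  | zero => exact ⟨hz, rfl⟩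
  | succ m ih => exact ⟨hz, ih (hσ b)⟩

theorem sum_map_iterate {G : SerreGraph V E} (ℓ : G.LengthFunction) (σ : E → E) (b : E) (m : ℕ) :
    ((List.iterate σ b m).map ℓ.len).sum = ∑ i ∈ Finset.range m, ℓ.len (σ^[i] b) := by
  induction m generalizing b with
  | zero => simp
  | succ m ih =>
    rw [List.iterate, List.map_cons, List.sum_cons, ih, Finset.sum_range_succ']
    simp only [Function.iterate_succ_apply, Function.iterate_zero_apply]
    ring

/-- The first time at which a path runs into a set of vertices or into itself. -/
theorem exists_first_hit [Finite V] (G : SerreGraph V E) (σ : E → E) (b : E) (S : Set V) :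
    ∃ m, 0 < m ∧ (G.o (σ^[m] b) ∈ S ∨ ∃ i < m, G.o (σ^[i] b) = G.o (σ^[m] b)) ∧
      (∀ j, 0 < j → j < m → G.o (σ^[j] b) ∉ S) ∧
      ∀ i < m, ∀ j < m, G.o (σ^[i] b) = G.o (σ^[j] b) → i = j := by
  classical
  have hex : ∃ m, 0 < m ∧ (G.o (σ^[m] b) ∈ S ∨ ∃ i < m, G.o (σ^[i] b) = G.o (σ^[m] b)) := by
    obtain ⟨i, j, hij, h⟩ := Finite.exists_ne_map_eq_of_infinite fun i => G.o (σ^[i] b)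
    rcases lt_or_gt_of_ne hij with hlt | hlt
    · exact ⟨j, by omega, Or.inr ⟨i, hlt, h⟩⟩
    · exact ⟨i, by omega, Or.inr ⟨j, hlt, h.symm⟩⟩
  have hmin := fun j (hj : j < Nat.find hex) => Nat.find_min hex hj
  refine ⟨Nat.find hex, (Nat.find_spec hex).1, (Nat.find_spec hex).2,
    fun j h0 hj hS => hmin j hj ⟨h0, Or.inl hS⟩, fun i hi j hj h => ?_⟩
  rcases lt_trichotomy i j with hlt | heq | hlt
  · exact absurd ⟨by omega, Or.inr ⟨i, hlt, h⟩⟩ (hmin j hj)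
  · exact heq
  · exact absurd ⟨by omega, Or.inr ⟨j, hlt, h.symm⟩⟩ (hmin i hi)

/-- A simple circuit `a, σ a, …, σᵏ a` together with an edge `b` leaving it at its origin. -/
structure IsExit (G : SerreGraph V E) (σ : E → E) (a : E) (k : ℕ) (b : E) : Prop where
  inj : ∀ i ≤ k, ∀ j ≤ k, G.o (σ^[i] a) = G.o (σ^[j] a) → i = j
  follows : G.Follows (σ^[k] a) a
  follows_exit : G.Follows (σ^[k] a) b
  ne : b ≠ a

/-- Otherwise σⁱ a ends at the base vertex, so i = k by simplicity, and then the exit backtracks. -/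
theorem IsExit.ne_bar {G : SerreGraph V E} {σ : E → E} (hσ : ∀ e, G.Follows e (σ e)) {a b : E}
    {k : ℕ} (h : G.IsExit σ a k b) : ∀ i ≤ k, b ≠ G.bar (σ^[i] a) := by
  intro i hi hb
  rcases Nat.lt_or_eq_of_le hi with hlt | rfl
  · have h1 : G.o (σ^[i + 1] a) = G.o (σ^[0] a) := by
      rw [Function.iterate_succ_apply', ← (hσ _).1, Function.iterate_zero_apply, ← h.follows.1,
        h.follows_exit.1, hb, G.o_bar]
    exact absurd (h.inj _ hlt _ (Nat.zero_le k) h1) (Nat.succ_ne_zero i)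
  · exact h.follows_exit.2 (by rw [hb, G.bar_bar])

/-- A simple circuit with an exit extends to two free loops, supported on the circuit and on
a simple path. -/
theorem IsExit.exists_loop [Finite V] {G : SerreGraph V E} (ℓ : G.LengthFunction) {σ : E → E}
    (hσ : ∀ e, G.Follows e (σ e)) {a b : E} {k : ℕ} (h : G.IsExit σ a k b) :
    ∃ m, 0 < m ∧ (∀ j, 0 < j → j < m → ∀ i ≤ k, G.o (σ^[i] a) ≠ G.o (σ^[j] b)) ∧
      (∀ i < m, ∀ j < m, G.o (σ^[i] b) = G.o (σ^[j] b) → i = j) ∧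
      ∃ y, G.Trail (σ^[k] a) (b :: y) (σ^[k] a) ∧
        ((b :: y).map ℓ.len).sum ≤ 2 * ∑ i ∈ Finset.range m, ℓ.len (σ^[i] b) +
          ∑ i ∈ Finset.range (k + 1), ℓ.len (σ^[i] a) ∧
        ∀ e ∈ b :: y, e ∈ List.iterate σ a (k + 1) ++ List.iterate σ b m ∨
          G.bar e ∈ List.iterate σ a (k + 1) ++ List.iterate σ b m := by
  obtain ⟨m, hm, hhit, havoid, hinj⟩ :=
    G.exists_first_hit σ b ((fun i => G.o (σ^[i] a)) '' Set.Iic k)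
  have havoid' : ∀ j, 0 < j → j < m → ∀ i ≤ k, G.o (σ^[i] a) ≠ G.o (σ^[j] b) :=
    fun j h0 hj i hi heq => havoid j h0 hj ⟨i, hi, heq⟩
  refine ⟨m, hm, havoid', hinj, ?_⟩
  obtain ⟨n, rfl⟩ := Nat.exists_eq_succ_of_ne_zero hm.ne'
  have hob : G.o b = G.o a := by rw [← h.follows.1, h.follows_exit.1]
  have htb : G.Trail (σ^[k] a) (List.iterate σ b (n + 1)) (σ^[n] b) :=
    trail_iterate hσ h.follows_exit n
  have hτ : G.τ (σ^[n] b) = G.o (σ^[n + 1] b) := by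
    rw [Function.iterate_succ_apply', (hσ _).1]
  -- If the path returns to the circuit, the loop continues along the circuit to its last edge.
  by_cases hS : ∃ p ≤ k, G.o (σ^[p] a) = G.o (σ^[n + 1] b)
  · obtain ⟨p, hp, hpo⟩ := hS
    have hfol : G.Follows (σ^[n] b) (σ^[p] a) := by
      refine ⟨hτ.trans hpo.symm, fun hbar => ?_⟩
      rcases Nat.eq_zero_or_pos n with rfl | hn
      · exact h.ne_bar hσ p hp hbar
      · have h1 : G.o (σ^[n] b) = G.τ (σ^[p] a) := by rw [hbar, G.o_bar]
        rcases Nat.lt_or_eq_of_le hp with hlt | rfl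
        · refine havoid' n hn (Nat.lt_succ_self n) (p + 1) hlt ?_
          rw [h1, Function.iterate_succ_apply', (hσ _).1]
        · refine havoid' n hn (Nat.lt_succ_self n) 0 (Nat.zero_le p) ?_
          rw [h1, h.follows.1, Function.iterate_zero_apply]
    have hta := trail_iterate hσ hfol (k - p)
    rw [← Function.iterate_add_apply, Nat.sub_add_cancel hp] at hta
    refine ⟨List.iterate σ (σ b) n ++ List.iterate σ (σ^[p] a) (k - p + 1),
      htb.append hta, ?_, ?_⟩
    · rw [← List.cons_append, ← List.iterate, List.map_append, List.sum_append, sum_map_iterate,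
        sum_map_iterate]
      have h1 : ∑ i ∈ Finset.range (k - p + 1), ℓ.len (σ^[i] (σ^[p] a)) ≤
          ∑ i ∈ Finset.range (k + 1), ℓ.len (σ^[i] a) := by
        have hsplit := Finset.sum_range_add (fun i => ℓ.len (σ^[i] a)) p (k - p + 1)
        rw [show p + (k - p + 1) = k + 1 by omega] at hsplit
        simp only [hsplit, ← Function.iterate_add_apply, add_comm _ p]
        exact le_add_of_nonneg_left (Finset.sum_nonneg fun i _ => (ℓ.pos _).le)
      have h2 : 0 ≤ ∑ i ∈ Finset.range (n + 1), ℓ.len (σ^[i] b) :=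
        Finset.sum_nonneg fun i _ => (ℓ.pos _).le
      linarith
    · intro e he
      refine Or.inl ?_
      rw [← List.cons_append, ← List.iterate] at he
      rcases List.mem_append.1 he with he | he
      · exact List.mem_append_right _ he
      · refine List.mem_append_left _ ?_
        obtain ⟨i, hi, rfl⟩ := List.mem_iterate.1 he
        rw [← Function.iterate_add_apply]
        exact List.mem_iterate.2 ⟨_, by omega, rfl⟩
  -- Otherwise the path meets itself: the loop goes once around the new cycle, returns along the
  -- stem, and then runs around the original circuit.
  · obtain ⟨i, hi, hio⟩ : ∃ i < n + 1, G.o (σ^[i] b) = G.o (σ^[n + 1] b) :=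
      hhit.resolve_left fun ⟨p, hp, hpo⟩ => hS ⟨p, hp, hpo⟩
    have hi0 : i ≠ 0 := by
      rintro rfl
      exact hS ⟨0, Nat.zero_le k, by rw [← hio]; exact hob.symm⟩
    obtain ⟨j, rfl⟩ := Nat.exists_eq_succ_of_ne_zero hi0
    have hfol : G.Follows (σ^[n] b) (G.bar (σ^[j] b)) := by
      refine ⟨?_, fun heq => ?_⟩
      · rw [hτ, ← hio, G.o_bar, Function.iterate_succ_apply', (hσ _).1]
      · rw [G.bar_bar] at heq
        have := hinj n (Nat.lt_succ_self n) j (by omega) (by rw [heq])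
        omega
    have hfol' : G.Follows (G.bar b) a :=
      ⟨by rw [G.τ_bar, hob], fun heq => h.ne (by rw [← G.bar_bar b, heq, G.bar_bar])⟩
    obtain ⟨y, hy, hysum, hymem⟩ : ∃ y, G.Trail (G.bar (σ^[j] b)) y (G.bar b) ∧
        (y.map ℓ.len).sum + ℓ.len (σ^[j] b) = ((List.iterate σ b (j + 1)).map ℓ.len).sum ∧
        ∀ e ∈ y, G.bar e ∈ List.iterate σ b (j + 1) := by
      cases j with
      | zero => exact ⟨[], rfl, by simp, by simp⟩
      | succ j => exact (trail_iterate hσ (hσ b) j).exists_reverse ℓ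
    have htr : G.Trail (σ^[k] a) (List.iterate σ b (n + 1) ++ (G.bar (σ^[j] b) :: y) ++
        List.iterate σ a (k + 1)) (σ^[k] a) :=
      (htb.append (b := σ^[n] b) (y := G.bar (σ^[j] b) :: y) ⟨hfol, hy⟩).append (trail_iterate hσ hfol' k)
    refine ⟨List.iterate σ (σ b) n ++ (G.bar (σ^[j] b) :: y) ++ List.iterate σ a (k + 1),
      htr, ?_, ?_⟩
    · rw [← List.cons_append, ← List.cons_append, ← List.iterate, List.map_append,
        List.sum_append, List.map_append, List.sum_append, List.map_cons, List.sum_cons,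
        ℓ.len_bar, add_comm (ℓ.len _), hysum, sum_map_iterate, sum_map_iterate, sum_map_iterate]
      have : ∑ i ∈ Finset.range (j + 1), ℓ.len (σ^[i] b) ≤
          ∑ i ∈ Finset.range (n + 1), ℓ.len (σ^[i] b) :=
        Finset.sum_le_sum_of_subset_of_nonneg (Finset.range_subset_range.2 hi.le)
          fun i _ _ => (ℓ.pos _).le
      linarith
    · have hsub : ∀ e ∈ List.iterate σ b (j + 1), e ∈ List.iterate σ b (n + 1) := by
        intro e he
        obtain ⟨i, hi', rfl⟩ := List.mem_iterate.1 he
        exact List.mem_iterate.2 ⟨i, by omega, rfl⟩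
      intro e he
      rw [← List.cons_append, ← List.cons_append, ← List.iterate] at he
      rcases List.mem_append.1 he with he | he
      · rcases List.mem_append.1 he with he | he
        · exact Or.inl (List.mem_append_right _ he)
        · refine Or.inr (List.mem_append_right _ (hsub _ ?_))
          rcases List.mem_cons.1 he with rfl | he
          · rw [G.bar_bar]
            exact List.mem_iterate.2 ⟨j, by omega, rfl⟩
          · exact hymem e he
      · exact Or.inl (List.mem_append_left _ he)

/-- The subgraph formed by all vertices and by the edges of a list. -/
def spanningSubgraph (G : SerreGraph V E) (L : List E) : G.Subgraph where
  verts := Set.univ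
  edges := {e | e ∈ L ∨ G.bar e ∈ L}
  bar_mem e he := by
    rcases he with he | he
    · exact Or.inr (by rwa [G.bar_bar])
    · exact Or.inl he
  o_mem _ _ := Set.mem_univ _

/-- An Euler characteristic count: circuit and path use at most k + 1 + m geometric edges, but pass
through k + m distinct vertices, namely k + 1 on the circuit and m - 1 inside the path. -/
theorem IsExit.isProper_spanningSubgraph [Fintype V] [Fintype E] {G : SerreGraph V E} {σ : E → E}
    {a b : E} {k m : ℕ} (h : G.IsExit σ a k b) (hm : 0 < m)
    (havoid : ∀ j, 0 < j → j < m → ∀ i ≤ k, G.o (σ^[i] a) ≠ G.o (σ^[j] b))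
    (hinj : ∀ i < m, ∀ j < m, G.o (σ^[i] b) = G.o (σ^[j] b) → i = j)
    (hcard : 2 * Fintype.card V + 2 < Fintype.card E) :
    (G.spanningSubgraph (List.iterate σ a (k + 1) ++ List.iterate σ b m)).IsProper := by
  classical
  rintro ⟨-, hedges⟩
  set L := List.iterate σ a (k + 1) ++ List.iterate σ b m with hL
  have hE : Fintype.card E ≤ 2 * (k + 1 + m) := by
    have hsub : (Finset.univ : Finset E) ⊆ L.toFinset ∪ L.toFinset.image G.bar := by
      intro e _
      have he : e ∈ (G.spanningSubgraph L).edges := hedges ▸ Set.mem_univ e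
      rw [Finset.mem_union, Finset.mem_image, List.mem_toFinset]
      rcases he with he | he
      · exact Or.inl he
      · exact Or.inr ⟨_, List.mem_toFinset.2 he, G.bar_bar e⟩
    have h1 := Finset.card_le_card hsub
    have h2 := Finset.card_union_le L.toFinset (L.toFinset.image G.bar)
    have h3 : (L.toFinset.image G.bar).card ≤ L.toFinset.card := Finset.card_image_le
    have h4 := L.toFinset_card_le
    have h5 : L.length = k + 1 + m := by
      rw [hL, List.length_append, List.length_iterate, List.length_iterate]
    rw [Finset.card_univ] at h1
    omega
  have hV : k + m ≤ Fintype.card V := by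
    let F : Fin (k + 1) ⊕ Fin (m - 1) → V :=
      Sum.elim (fun i => G.o (σ^[i] a)) fun j => G.o (σ^[j + 1] b)
    have hF : Function.Injective F := by
      refine Function.Injective.sumElim ?_ ?_ ?_
      · intro i j hij
        exact Fin.ext (h.inj _ (Nat.lt_succ_iff.1 i.2) _ (Nat.lt_succ_iff.1 j.2) hij)
      · intro i j hij
        have := hinj (i + 1) (by omega) (j + 1) (by omega) hij
        exact Fin.ext (by omega)
      · intro i j
        exact havoid (j + 1) (Nat.succ_pos _) (by omega) _ (Nat.lt_succ_iff.1 i.2)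
    have := Fintype.card_le_of_injective F hF
    rw [Fintype.card_sum, Fintype.card_fin, Fintype.card_fin] at this
    omega
  omega


/-! ### Dominant followers of a subsolution -/

/-- A subsolution `w` of the transfer operator with exponent `1 / 2`, normalized to have
maximum `1`, and a choice `σ` of followers where `w` is largest. -/
structure IsDominant [Fintype E] (G : SerreGraph V E) (ℓ : G.LengthFunction) (w : E → ℝ)
    (σ : E → E) : Prop where
  nonneg : ∀ e, 0 ≤ w e
  le_one : ∀ e, w e ≤ 1
  exists_eq_one : ∃ e, w e = 1
  le_sum : ∀ e, w e ≤ Real.exp (-(1 / 2 * ℓ.len e)) * ∑ f ∈ G.followers e, w f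
  follows : ∀ e, G.Follows e (σ e)
  le_apply : ∀ e f, G.Follows e f → w f ≤ w (σ e)

section

variable [Fintype E] {G : SerreGraph V E} {ℓ : G.LengthFunction} {w : E → ℝ} {σ : E → E} {q : ℕ}

theorem HasEntropy.exists_isDominant (hG : G.HasEntropy ℓ 1) (hfol : ∀ e, ∃ f, G.Follows e f) :
    ∃ w σ, G.IsDominant ℓ w σ := by
  -- Any fixed exponent strictly between 0 and 1 would serve.
  obtain ⟨w, h0, h1, h2, h3⟩ := hG.exists_subsolution (s := 1 / 2) (by norm_num) (by norm_num)
  have hmax : ∀ e, ∃ f ∈ G.followers e, ∀ g ∈ G.followers e, w g ≤ w f := fun e =>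
    Finset.exists_max_image _ w (let ⟨f, hf⟩ := hfol e; ⟨f, mem_followers.2 hf⟩)
  choose σ hσ hle using hmax
  exact ⟨w, σ, h0, h1, h2, h3, fun e => mem_followers.1 (hσ e),
    fun e f hf => hle e f (mem_followers.2 hf)⟩

theorem sum_range_le_of_injOn {F : E → ℕ} (hq : ∑ e, F e ≤ q) {u : ℕ → E} {m : ℕ}
    (hinj : ∀ i < m, ∀ j < m, u i = u j → i = j) : ∑ i ∈ Finset.range m, F (u i) ≤ q := by
  classical
  rw [← Finset.sum_image (f := F) (g := u) fun i hi j hj h =>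
    hinj i (Finset.mem_range.1 hi) j (Finset.mem_range.1 hj) h]
  exact (Finset.sum_le_univ_sum_of_nonneg fun _ => Nat.zero_le _).trans hq

namespace IsDominant

theorem card_followers_pos (h : G.IsDominant ℓ w σ) (e : E) : 0 < (G.followers e).card :=
  Finset.card_pos.2 ⟨σ e, mem_followers.2 (h.follows e)⟩

/-- The estimate d ≤ 2^(d-1) makes the branching factors multiply to a power whose exponent is the
total surplus of followers. -/
theorem le_two_pow_mul (h : G.IsDominant ℓ w σ) (e : E) :
    w e ≤ 2 ^ ((G.followers e).card - 1) * Real.exp (-(1 / 2 * ℓ.len e)) * w (σ e) := by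
  have h1 : ∑ f ∈ G.followers e, w f ≤ (G.followers e).card * w (σ e) := by
    rw [← nsmul_eq_mul]
    exact Finset.sum_le_card_nsmul _ _ _ fun f hf => h.le_apply e f (mem_followers.1 hf)
  have h2 : ((G.followers e).card : ℝ) ≤ 2 ^ ((G.followers e).card - 1) := by
    have h3 := Nat.lt_two_pow_self (n := (G.followers e).card - 1)
    have h4 := h.card_followers_pos e
    exact_mod_cast (by omega : (G.followers e).card ≤ 2 ^ ((G.followers e).card - 1))
  calc w e ≤ Real.exp (-(1 / 2 * ℓ.len e)) * ∑ f ∈ G.followers e, w f := h.le_sum e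
    _ ≤ Real.exp (-(1 / 2 * ℓ.len e)) * (2 ^ ((G.followers e).card - 1) * w (σ e)) :=
      mul_le_mul_of_nonneg_left (h1.trans (mul_le_mul_of_nonneg_right h2 (h.nonneg _)))
        (Real.exp_pos _).le
    _ = _ := by ring

/-- Without repetitions each edge spends its surplus of followers at most once, so the total factor
is at most 2^q however long the orbit segment is. -/
theorem le_iterate (h : G.IsDominant ℓ w σ) (hq : ∑ e, ((G.followers e).card - 1) ≤ q) (b : E)
    {m : ℕ} (hinj : ∀ i < m, ∀ j < m, σ^[i] b = σ^[j] b → i = j) :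
    w b ≤ 2 ^ q * Real.exp (-(1 / 2 * ∑ i ∈ Finset.range m, ℓ.len (σ^[i] b))) * w (σ^[m] b) := by
  have key : ∀ m, w b ≤ 2 ^ (∑ i ∈ Finset.range m, ((G.followers (σ^[i] b)).card - 1)) *
      Real.exp (-(1 / 2 * ∑ i ∈ Finset.range m, ℓ.len (σ^[i] b))) * w (σ^[m] b) := by
    intro m
    induction m with
    | zero => simp
    | succ m ih =>
      refine ih.trans ?_
      have h1 := h.le_two_pow_mul (σ^[m] b)
      rw [← Function.iterate_succ_apply' σ] at h1
      refine (mul_le_mul_of_nonneg_left h1 (by positivity)).trans_eq ?_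
      rw [Finset.sum_range_succ, Finset.sum_range_succ, pow_add, mul_add, neg_add, Real.exp_add]
      ring
  refine (key m).trans ?_
  have := h.nonneg (σ^[m] b)
  gcongr
  · norm_num
  · exact sum_range_le_of_injOn (F := fun e => (G.followers e).card - 1) hq hinj

theorem one_le_of_orbit (h : G.IsDominant ℓ w σ) (hq : ∑ e, ((G.followers e).card - 1) ≤ q)
    {e : E} (he : w e = 1) (i : ℕ) : 1 ≤ 2 ^ q * w (σ^[i] e) := by
  classical
  -- The first time at which this edge is reached has no repetition before it.
  have hex : ∃ j, σ^[j] e = σ^[i] e := ⟨i, rfl⟩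
  have hspec := Nat.find_spec hex
  have hinj : ∀ x < Nat.find hex, ∀ y < Nat.find hex, σ^[x] e = σ^[y] e → x = y := by
    have hlt : ∀ x y, x < y → y < Nat.find hex → σ^[x] e ≠ σ^[y] e := by
      intro x y hxy hy heq
      refine Nat.find_min hex (m := Nat.find hex - y + x) (by omega) ?_
      rw [Function.iterate_add_apply, heq, ← Function.iterate_add_apply,
        Nat.sub_add_cancel hy.le, hspec]
    intro x hx y hy heq
    rcases lt_trichotomy x y with hxy | hxy | hxy
    · exact absurd heq (hlt x y hxy hy)
    · exact hxy
    · exact absurd heq.symm (hlt y x hxy hx)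
  have h1 := h.le_iterate hq e hinj
  rw [hspec, he] at h1
  refine h1.trans (mul_le_mul_of_nonneg_right ?_ (h.nonneg _))
  refine mul_le_of_le_one_right (by positivity) (Real.exp_le_one_iff.2 ?_)
  have := Finset.sum_nonneg fun i (_ : i ∈ Finset.range (Nat.find hex)) => (ℓ.pos (σ^[i] e)).le
  linarith

theorem le_add_of_exits_le (h : G.IsDominant ℓ w σ) {θ : ℝ} {e : E}
    (hexit : ∀ f, G.Follows e f → f ≠ σ e → w f ≤ θ) :
    w e ≤ Real.exp (-(1 / 2 * ℓ.len e)) * w (σ e) + ((G.followers e).card - 1 : ℕ) * θ := by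
  classical
  have hmem : σ e ∈ G.followers e := mem_followers.2 (h.follows e)
  have h1 : ∑ f ∈ (G.followers e).erase (σ e), w f ≤ ((G.followers e).card - 1 : ℕ) * θ := by
    rw [← Finset.card_erase_of_mem hmem, ← nsmul_eq_mul]
    exact Finset.sum_le_card_nsmul _ _ _ fun f hf =>
      hexit f (mem_followers.1 (Finset.mem_of_mem_erase hf)) (Finset.ne_of_mem_erase hf)
  have h2 := h.le_sum e
  rw [← Finset.add_sum_erase _ _ hmem, mul_add] at h2
  have h3 : Real.exp (-(1 / 2 * ℓ.len e)) ≤ 1 :=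
    Real.exp_le_one_iff.2 (by linarith [ℓ.pos e])
  have h4 : 0 ≤ ∑ f ∈ (G.followers e).erase (σ e), w f := Finset.sum_nonneg fun f _ => h.nonneg f
  nlinarith

/-- If all exits are light, the weight must persist along the orbit. Around a periodic orbit of
length A this gives (1 - exp(-A/2)) w(a) ≤ qθ. -/
theorem le_iterate_add_of_exits_le (h : G.IsDominant ℓ w σ) {θ : ℝ} (hθ : 0 ≤ θ) (a : E)
    (m : ℕ) (hexit : ∀ i < m, ∀ f, G.Follows (σ^[i] a) f → f ≠ σ (σ^[i] a) → w f ≤ θ) :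
    w a ≤ Real.exp (-(1 / 2 * ∑ i ∈ Finset.range m, ℓ.len (σ^[i] a))) * w (σ^[m] a) +
      (∑ i ∈ Finset.range m, ((G.followers (σ^[i] a)).card - 1) : ℕ) * θ := by
  induction m with
  | zero => simp
  | succ m ih =>
    have h1 := ih fun i hi => hexit i (by omega)
    have h2 := h.le_add_of_exits_le (hexit m (Nat.lt_succ_self m))
    rw [← Function.iterate_succ_apply' σ] at h2
    have h3 : Real.exp (-(1 / 2 * ∑ i ∈ Finset.range m, ℓ.len (σ^[i] a))) ≤ 1 := by
      have := Finset.sum_nonneg fun i (_ : i ∈ Finset.range m) => (ℓ.pos (σ^[i] a)).le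
      exact Real.exp_le_one_iff.2 (by linarith)
    have h4 := Real.exp_pos (-(1 / 2 * ∑ i ∈ Finset.range m, ℓ.len (σ^[i] a)))
    have h5 : 0 ≤ (((G.followers (σ^[m] a)).card - 1 : ℕ) : ℝ) * θ := by positivity
    rw [Finset.sum_range_succ, Finset.sum_range_succ, mul_add (1 / 2 : ℝ), neg_add, Real.exp_add,
      Nat.cast_add, add_mul, mul_assoc (Real.exp _)]
    nlinarith

/-- There is a short simple circuit along `σ` with an exit which is not too unlikely. -/
theorem exists_isExit [Finite V] (h : G.IsDominant ℓ w σ)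
    (hq : ∑ e, ((G.followers e).card - 1) ≤ q) (hq0 : 0 < q) :
    ∃ a k b, G.IsExit σ a k b ∧ 1 ≤ 2 ^ q * w a ∧
      1 - Real.exp (-(1 / 2 * ∑ i ∈ Finset.range (k + 1), ℓ.len (σ^[i] a))) ≤
        2 * 2 ^ q * q * w b := by
  obtain ⟨e, he⟩ := h.exists_eq_one
  obtain ⟨m, hm, hhit, -, hinj⟩ := G.exists_first_hit σ e ∅
  obtain ⟨i, hi, hio⟩ := hhit.resolve_left id
  obtain ⟨k, rfl⟩ : ∃ k, m = i + k + 1 := ⟨m - i - 1, by omega⟩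
  set a := σ^[i] e with ha
  have hiter : ∀ j, σ^[j] a = σ^[i + j] e := fun j => by
    rw [ha, ← Function.iterate_add_apply, add_comm]
  have hainj : ∀ x ≤ k, ∀ y ≤ k, G.o (σ^[x] a) = G.o (σ^[y] a) → x = y := by
    intro x hx y hy hxy
    rw [hiter, hiter] at hxy
    have := hinj _ (by omega) _ (by omega) hxy
    omega
  have hao : G.o a = G.o (σ^[k + 1] a) := by rw [hiter, hio]; rfl
  have horb : ∀ j, 1 ≤ 2 ^ q * w (σ^[j] a) := fun j => by
    rw [hiter]; exact h.one_le_of_orbit hq he _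
  have hq1 : (1 : ℝ) ≤ q := by exact_mod_cast hq0
  -- The orbit has returned to a vertex, not necessarily to an edge. If the edge differs from `a`,
  -- it is itself an exit of weight at least 2^(-q).
  by_cases hper : σ^[k + 1] a = a
  -- Half the value that w(a) ≥ 2^(-q) allows, so that not all exits can have weight at most θ.
  · set θ : ℝ := (1 - Real.exp (-(1 / 2 * ∑ i ∈ Finset.range (k + 1), ℓ.len (σ^[i] a)))) /
      (2 * 2 ^ q * q) with hθ
    -- The heavy exit may occur anywhere on the circuit, so the base point has to be rotated to it.
    have hrot : ∀ j, σ^[k + 1] (σ^[j] a) = σ^[j] a ∧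
        (∀ x ≤ k, ∀ y ≤ k, G.o (σ^[x] (σ^[j] a)) = G.o (σ^[y] (σ^[j] a)) → x = y) ∧
        ∑ i ∈ Finset.range (k + 1), ℓ.len (σ^[i] (σ^[j] a)) =
          ∑ i ∈ Finset.range (k + 1), ℓ.len (σ^[i] a) := by
      intro j
      induction j with
      | zero => exact ⟨hper, hainj, rfl⟩
      | succ j ih =>
        obtain ⟨h1, h2, h3⟩ := ih
        rw [Function.iterate_succ_apply' σ j a]
        set c := σ^[j] a
        refine ⟨?_, ?_, ?_⟩
        · rw [← Function.iterate_succ_apply σ (k + 1) c, Function.iterate_succ_apply' σ, h1]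
        · have hk : ∀ x ≤ k, ∃ x' ≤ k, σ^[x] (σ c) = σ^[x'] c ∧ (x' = x + 1 ∨ x' = 0 ∧ x = k) := by
            intro x hx
            rcases Nat.lt_or_eq_of_le hx with hlt | rfl
            · exact ⟨x + 1, hlt, rfl, Or.inl rfl⟩
            · exact ⟨0, Nat.zero_le _, h1, Or.inr ⟨rfl, rfl⟩⟩
          intro x hx y hy hxy
          obtain ⟨x', hx', hxe, hxc⟩ := hk x hx
          obtain ⟨y', hy', hye, hyc⟩ := hk y hy
          rw [hxe, hye] at hxy
          have := h2 x' hx' y' hy' hxy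
          omega
        · rw [← h3, Finset.sum_range_succ, Finset.sum_range_succ',
            Function.iterate_zero_apply, ← Function.iterate_succ_apply σ k c, h1]
          rfl
    have hsum0 : 0 < ∑ i ∈ Finset.range (k + 1), ℓ.len (σ^[i] a) :=
      Finset.sum_pos (fun i _ => ℓ.pos _) ⟨0, by simp⟩
    have hexp : Real.exp (-(1 / 2 * ∑ i ∈ Finset.range (k + 1), ℓ.len (σ^[i] a))) < 1 :=
      Real.exp_lt_one_iff.2 (by linarith)
    have hθ0 : 0 < θ := div_pos (by linarith) (by positivity)
    obtain ⟨j, f, hf, hfne, hfw⟩ : ∃ j, ∃ f, G.Follows (σ^[j] a) f ∧ f ≠ σ (σ^[j] a) ∧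
        θ < w f := by
      by_contra! hcon
      have h1 := h.le_iterate_add_of_exits_le hθ0.le a (k + 1) fun i _ => hcon i
      rw [hper] at h1
      have h2 := sum_range_le_of_injOn (F := fun e => (G.followers e).card - 1) hq
        (u := fun i => σ^[i] a) (m := k + 1) fun x hx y hy hxy =>
          hainj x (by omega) y (by omega) (congrArg G.o hxy)
      have h3 : ((∑ i ∈ Finset.range (k + 1), ((G.followers (σ^[i] a)).card - 1) : ℕ) : ℝ) ≤ q := by
        exact_mod_cast h2
      have h4 := horb 0
      rw [Function.iterate_zero_apply] at h4
      have h5 : 2 * 2 ^ q * (q * θ) =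
          1 - Real.exp (-(1 / 2 * ∑ i ∈ Finset.range (k + 1), ℓ.len (σ^[i] a))) := by
        rw [hθ]; field_simp
      have h6 := mul_le_mul_of_nonneg_right h3 hθ0.le
      have h7 : (0 : ℝ) < 2 ^ q := by positivity
      have h8 : w a * (2 * 2 ^ q * (q * θ)) ≤ q * θ := by
        rw [h5]; linarith
      have h9 : 0 < q * θ := by positivity
      nlinarith
    obtain ⟨h1, h2, h3⟩ := hrot (j + 1)
    have h4 : σ^[k] (σ^[j + 1] a) = σ^[j] a := by
      rw [Function.iterate_succ_apply', ← Function.iterate_succ_apply]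
      exact (hrot j).1
    refine ⟨σ^[j + 1] a, k, f, ⟨h2, ?_, ?_, ?_⟩, horb _, ?_⟩
    · rw [h4, Function.iterate_succ_apply']
      exact h.follows _
    · rwa [h4]
    · rwa [Function.iterate_succ_apply']
    · rw [h3]
      rw [hθ, div_lt_iff₀ (by positivity)] at hfw
      linarith
  · have hτ : G.τ (σ^[k] a) = G.o (σ^[k + 1] a) := by
      rw [Function.iterate_succ_apply', (h.follows _).1]
    refine ⟨a, k, σ^[k + 1] a, ⟨hainj, ⟨by rw [hτ, hao], fun hbar => ?_⟩, ?_, hper⟩, horb 0, ?_⟩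
    · rcases Nat.eq_zero_or_pos k with rfl | hk
      · exact G.bar_ne a hbar.symm
      · have h1 : G.o (σ^[k] a) = G.o (σ^[1] a) := by
          rw [hbar, G.o_bar, (h.follows a).1]; rfl
        have h2 := hainj k le_rfl 1 hk h1
        subst h2
        exact (h.follows a).2 (by rw [← Function.iterate_one σ, hbar, G.bar_bar])
    · rw [Function.iterate_succ_apply']
      exact h.follows _
    · have h1 := horb (k + 1)
      have h2 := Real.exp_pos (-(1 / 2 * ∑ i ∈ Finset.range (k + 1), ℓ.len (σ^[i] a)))
      nlinarith

end IsDominant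

end


/-! ### The lower bound -/

/-- The lower bound for the entropy of a proper subgraph, in terms of the number of branches. -/
noncomputable def entropyBound (q : ℕ) : ℝ :=
  Real.log 2 / (2 + 16 * (q * Real.log 2) + 4 * Real.log (2 * q * (2 ^ q * 2 ^ q)) +
    4 * Real.log 2)

theorem log_const_nonneg {q : ℕ} (hq : 0 < q) : 0 ≤ Real.log (2 * q * (2 ^ q * 2 ^ q)) := by
  have hq1 : (1 : ℝ) ≤ q := by exact_mod_cast hq
  have h1 : (1 : ℝ) ≤ 2 ^ q * 2 ^ q :=
    one_le_mul_of_one_le_of_one_le (one_le_pow₀ (by norm_num)) (one_le_pow₀ (by norm_num))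
  exact Real.log_nonneg (by nlinarith)

theorem entropyBound_pos {q : ℕ} (hq : 0 < q) : 0 < entropyBound q := by
  have h1 := Real.log_pos (by norm_num : (1 : ℝ) < 2)
  have h2 := log_const_nonneg hq
  exact div_pos h1 (by positivity)

theorem entropyBound_le_one {q : ℕ} (hq : 0 < q) : entropyBound q ≤ 1 := by
  have h1 := Real.log_pos (by norm_num : (1 : ℝ) < 2)
  have h2 := log_const_nonneg hq
  have h3 : (0 : ℝ) ≤ 16 * (q * Real.log 2) := by positivity
  exact (div_le_one (by positivity)).2 (by linarith)

/-- With D = 1 - exp(-A/2), the choice N = ⌈1/D⌉ + 1 balances both loops: A/D ≤ 2 + A keeps NA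
bounded, while L is at most a constant plus 2 log N. The resulting quotient log N / (K + 4 log N)
increases with N, and N ≥ 2. -/
theorem exists_entropyBound_le {q : ℕ} (hq : 0 < q) {A L B : ℝ} (hA : 0 < A)
    (hA1 : 1 ≤ 2 ^ q * 2 ^ q * Real.exp (-(1 / 2 * A)))
    (hL : 1 - Real.exp (-(1 / 2 * A)) ≤ 2 * q * (2 ^ q * 2 ^ q) * Real.exp (-(1 / 2 * L)))
    (hB : B ≤ 2 * L + A) (hB0 : 0 < B) :
    ∃ N : ℕ, N ≠ 0 ∧ entropyBound q ≤ Real.log N / (N * A + B) := by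
  set D : ℝ := 1 - Real.exp (-(1 / 2 * A)) with hD
  have hD0 : 0 < D := sub_pos.2 (Real.exp_lt_one_iff.2 (by linarith))
  have hq0 : (0 : ℝ) < q := by exact_mod_cast hq
  set c : ℝ := Real.log (2 * q * (2 ^ q * 2 ^ q)) with hc
  have hc0 : 0 ≤ c := log_const_nonneg hq
  have hlog2 := Real.log_pos (by norm_num : (1 : ℝ) < 2)
  set N : ℕ := ⌈1 / D⌉₊ + 1 with hN
  have hDinv : 0 < 1 / D := by positivity
  have hN2 : (2 : ℝ) ≤ N := by
    have : 1 ≤ ⌈1 / D⌉₊ := Nat.one_le_iff_ne_zero.2 (Nat.ceil_pos.2 hDinv).ne'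
    exact_mod_cast (by omega : 2 ≤ N)
  have hN1 : 1 / D ≤ N := by
    have := Nat.le_ceil (1 / D)
    rw [hN]; push_cast; linarith
  have hN3 : (N : ℝ) ≤ 1 / D + 2 := by
    have := (Nat.ceil_lt_add_one hDinv.le).le
    rw [hN]; push_cast; linarith
  have hAle : A ≤ 4 * (q * Real.log 2) := by
    have h1 := Real.log_le_log one_pos hA1
    rw [Real.log_one, Real.log_mul (by positivity) (Real.exp_pos _).ne', Real.log_exp,
      Real.log_mul (by positivity) (by positivity), Real.log_pow] at h1
    linarith
  have hLle : L ≤ 2 * c + 2 * Real.log N := by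
    have h1 := Real.log_le_log hD0 hL
    rw [Real.log_mul (by positivity) (Real.exp_pos _).ne', Real.log_exp, ← hc] at h1
    have h2 := Real.log_le_log hDinv hN1
    rw [one_div, Real.log_inv] at h2
    linarith
  have hNA : N * A ≤ 2 + 3 * A := by
    have h1 : 1 / D * A ≤ 2 + A := by
      rw [one_div, inv_mul_le_iff₀ hD0]
      have h2 := Real.add_one_le_exp (1 / 2 * A)
      have h3 : Real.exp (1 / 2 * A) * Real.exp (-(1 / 2 * A)) = 1 := by
        rw [← Real.exp_add, add_neg_cancel, Real.exp_zero]
      have h4 := mul_le_mul_of_nonneg_right h2 (Real.exp_pos (-(1 / 2 * A))).le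
      rw [h3] at h4
      rw [hD]
      linarith
    nlinarith
  have hlogN : Real.log 2 ≤ Real.log N := Real.log_le_log (by norm_num) hN2
  refine ⟨N, Nat.succ_ne_zero _, ?_⟩
  have hden : N * A + B ≤ 2 + 16 * (q * Real.log 2) + 4 * c + 4 * Real.log N := by linarith
  have hK : 0 ≤ 2 + 16 * (q * Real.log 2) + 4 * c := by positivity
  rw [entropyBound, ← hc, div_le_div_iff₀ (by positivity) (by positivity)]
  calc Real.log 2 * (N * A + B)
      ≤ Real.log 2 * (2 + 16 * (q * Real.log 2) + 4 * c + 4 * Real.log N) :=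
        mul_le_mul_of_nonneg_left hden hlog2.le
    _ ≤ _ := by nlinarith

/-- A finite graph of entropy one without dead ends has a proper subgraph whose entropy is bounded
below in terms of the number of branches. -/
theorem HasEntropy.exists_isProper_of_follows [Fintype V] [Fintype E] {G : SerreGraph V E}
    {ℓ : G.LengthFunction} (hG : G.HasEntropy ℓ 1) (hfol : ∀ e, ∃ f, G.Follows e f) {q : ℕ}
    (hq0 : 0 < q) (hq : ∑ e, ((G.followers e).card - 1) ≤ q)
    (hcard : 2 * Fintype.card V + 2 < Fintype.card E) :
    ∃ H : G.Subgraph, H.IsProper ∧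
      ∃ h, H.toGraph.HasEntropy (ℓ.restrict H) h ∧ entropyBound q ≤ h := by
  obtain ⟨w, σ, hw⟩ := hG.exists_isDominant hfol
  obtain ⟨a, k, b, hab, hwa, hwb⟩ := hw.exists_isExit hq hq0
  obtain ⟨m, hm, havoid, hinj, y, hy, hysum, hymem⟩ := hab.exists_loop ℓ hw.follows
  set H := G.spanningSubgraph (List.iterate σ a (k + 1) ++ List.iterate σ b m)
  obtain ⟨h, hh⟩ := H.exists_hasEntropy hG
  refine ⟨H, hab.isProper_spanningSubgraph hm havoid hinj hcard, h, hh, ?_⟩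
  have h2q : (0 : ℝ) < 2 ^ q := by positivity
  have hA1 : 1 ≤ 2 ^ q * 2 ^ q *
      Real.exp (-(1 / 2 * ∑ i ∈ Finset.range (k + 1), ℓ.len (σ^[i] a))) := by
    have h1 := hw.le_iterate hq a (m := k + 1) fun x hx z hz hxz =>
      hab.inj x (by omega) z (by omega) (congrArg G.o hxz)
    have h2 := h1.trans (mul_le_of_le_one_right (by positivity) (hw.le_one _))
    have h3 := hwa.trans (mul_le_mul_of_nonneg_left h2 h2q.le)
    rwa [← mul_assoc] at h3
  have hL : 1 - Real.exp (-(1 / 2 * ∑ i ∈ Finset.range (k + 1), ℓ.len (σ^[i] a))) ≤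
      2 * q * (2 ^ q * 2 ^ q) *
        Real.exp (-(1 / 2 * ∑ i ∈ Finset.range m, ℓ.len (σ^[i] b))) := by
    have h1 := hw.le_iterate hq b (m := m) fun x hx z hz hxz =>
      hinj x hx z hz (congrArg G.o hxz)
    have h2 := h1.trans (mul_le_of_le_one_right (by positivity) (hw.le_one _))
    refine hwb.trans ((mul_le_mul_of_nonneg_left h2 (by positivity)).trans_eq ?_)
    ring
  have hB0 : 0 < ((b :: y).map ℓ.len).sum := by
    rw [List.map_cons, List.sum_cons]
    exact add_pos_of_pos_of_nonneg (ℓ.pos b) (ℓ.sum_nonneg y)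
  obtain ⟨N, hN, hle⟩ := exists_entropyBound_le hq0
    (Finset.sum_pos (fun i _ => ℓ.pos _) ⟨0, by simp⟩) hA1 hL hysum hB0
  have hmemH : ∀ e ∈ List.iterate σ a (k + 1), e ∈ H.edges := fun e he =>
    Or.inl (List.mem_append_left _ he)
  have key := H.log_div_le_of_trail hh (x := List.iterate σ (σ a) k) hab.ne.symm
    (trail_iterate hw.follows hab.follows k) hy
    (hmemH _ (List.mem_iterate.2 ⟨k, by omega, rfl⟩)) hmemH hymem hN
  rw [← List.iterate, sum_map_iterate] at key
  exact hle.trans key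

end SerreGraph

open SerreGraph in
theorem theorem1p2 (r : ℕ) (hr : 3 ≤ r) :
    ∃ C : ℝ, 0 < C ∧
      ∀ (V : Type u) (E : Type v) [Finite V] [Finite E] (G : SerreGraph V E),
        G.Connected → G.HasRank r →
          ∀ ℓ : G.LengthFunction, G.HasEntropy ℓ 1 →
            ∃ H : G.Subgraph, H.IsProper ∧
              ∃ h : ℝ, H.toGraph.HasEntropy (ℓ.restrict H) h ∧ C ≤ h := by
  have hn : 0 < 2 * r - 2 := by omega
  have hq : 0 < (2 * r - 2) * (2 * r - 2 + 2) := Nat.mul_pos hn (by omega)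
  refine ⟨entropyBound ((2 * r - 2) * (2 * r - 2 + 2)), entropyBound_pos hq, ?_⟩
  intro V E _ _ G hconn hrank ℓ hent
  have := Fintype.ofFinite V
  have := Fintype.ofFinite E
  have hcard := card_edges_eq hconn hrank
  -- A dead end can be removed at no cost in entropy. Otherwise r ≥ 3 gives |E| ≥ 2|V| + 4, two more
  -- than the circuit and path can account for.
  by_cases hfol : ∀ e, ∃ f, G.Follows e f
  · exact hent.exists_isProper_of_follows hfol hq
      (sum_card_followers_sub_one_le hconn hfol (by omega)) (by omega)
  · push Not at hfol
    obtain ⟨e, he⟩ := hfol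
    obtain ⟨H, hH, hHent⟩ := hent.exists_isProper he
    exact ⟨H, hH, 1, hHent, entropyBound_le_one hq⟩
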